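/- Let $n\in\{1,2,3\}$ and let $\Omega\subset\mathbb R^n$ be a bounded Lipschitz domain. Let $c_\Omega$ be its Poincaré constant, i.e. the least constant $c$ with $\|v\|_{L^2(\Omega)}^2\le c\,\|\nabla v\|_{L^2(\Omega)}^2$ for all $v\in H^1_0(\Omega)$, and assume $c_\Omega<4$. For functions $U,u$ on $\Omega$ put $$\Phi(U,u):=\frac{e^{-(U+u)}}{\int_\Omega e^{-(U(x)+u(x))}\,dx}.$$ Let $D(\Omega)$ be one of the following sets of controls: 1. if $n=1$: $D(\Omega)=H^1_0(\Omega)$, with the $H^1$ norm; 2. if $n\in\{2,3\}$: $D(\Omega)=\{v\in H^1_0(\Omega): M_1\le v\le M_2 \text{ a.e. in }\Omega\}$ for fixed $M_1,M_2\in\mathbb R$, with the $H^1$ norm; 3. if $n\in\{2,3\}$: $D(\Omega)=H^2_0(\Omega)=\{v\in H^1_0(\Omega)\cap H^2(\Omega):\nabla v=0 \text{ on }\partial\Omega\}$, with the $H^2$ norm. Then for every $u\in D(\Omega)$ the boundary value problem $$-\Delta U=\Phi(U,u)\ \text{ in }\Omega,\qquad U=0\ \text{ on }\partial\Omega,$$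 has exactly one weak solution $U\in H^1_0(\Omega)$ (with $e^{-(U+u)}\in L^1(\Omega)$), and the control-to-state map $S:D(\Omega)\to L^2(\Omega)$, $u\mapsto U=S(u)$, is Fréchet differentiable at every $u \in D(\Omega)$. In case 2 this means differentiability relative to the set $D(\Omega)$: there is a bounded linear map $S'(u):H^1_0(\Omega)\to L^2(\Omega)$ with $\|S(v)-S(u)-S'(u)(v-u)\|_{L^2(\Omega)}=o(\|v-u\|_{H^1(\Omega)})$ as $v\to u$, $v\in D(\Omega)$. -/

import Mathlib

open MeasureTheory Set
open scoped ContDiff ENNReal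

noncomputable section

namespace PoissonBoltzmann

/-- A Lipschitz domain in `ℝⁿ`: a nonempty, bounded, connected open set such that, in a
neighbourhood of each boundary point and in suitable Cartesian coordinates (the last axis being
the unit vector `e`), it is the set of points strictly above the graph of a Lipschitz function
of the coordinates orthogonal to `e`. -/
structure IsLipschitzDomain {n : ℕ} (Ω : Set (EuclideanSpace ℝ (Fin n))) : Prop where
  isOpen : IsOpen Ω
  isConnected : IsConnected Ω
  isBounded : Bornology.IsBounded Ω
  exists_graph : ∀ x ∈ frontier Ω,
    ∃ (r : ℝ) (e : EuclideanSpace ℝ (Fin n)) (γ : EuclideanSpace ℝ (Fin n) → ℝ) (K : NNReal),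
      0 < r ∧ ‖e‖ = 1 ∧ LipschitzWith K γ ∧
      ∀ y ∈ Metric.ball x r, y ∈ Ω ↔ γ (y - inner ℝ e y • e) < inner ℝ e y

/-- `L²(Ω)`. -/
abbrev L2 {n : ℕ} (Ω : Set (EuclideanSpace ℝ (Fin n))) : Type :=
  Lp ℝ 2 (volume.restrict Ω)

/-- `C_c^∞(Ω)`. -/
def IsTestFunction {n : ℕ} (Ω : Set (EuclideanSpace ℝ (Fin n)))
    (φ : EuclideanSpace ℝ (Fin n) → ℝ) : Prop :=
  ContDiff ℝ ∞ φ ∧ HasCompactSupport φ ∧ tsupport φ ⊆ Ω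

/-- The classical partial derivative `∂ᵢφ`. -/
def pderiv {n : ℕ} (i : Fin n) (φ : EuclideanSpace ℝ (Fin n) → ℝ)
    (x : EuclideanSpace ℝ (Fin n)) : ℝ :=
  fderiv ℝ φ x (EuclideanSpace.single i 1)

/-- Families of `L²(Ω)` functions indexed by the partial derivatives of order at most one:
the index `none` is for the function and `some i` for its `i`-th derivative. The norm is
`(‖v‖² + ∑ᵢ ‖∂ᵢv‖²)^(1/2)`, the norm of `H¹(Ω)`. -/
abbrev Jet1 {n : ℕ} (Ω : Set (EuclideanSpace ℝ (Fin n))) : Type :=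
  PiLp 2 (fun _ : Option (Fin n) => L2 Ω)

/-- The pairs `(φ, ∇φ)` with `φ ∈ C_c^∞(Ω)`. -/
def testJets {n : ℕ} (Ω : Set (EuclideanSpace ℝ (Fin n))) : Submodule ℝ (Jet1 Ω) where
  carrier := {f | ∃ φ, IsTestFunction Ω φ ∧ f none =ᵐ[volume.restrict Ω] φ ∧
    ∀ i, f (some i) =ᵐ[volume.restrict Ω] pderiv i φ}
  zero_mem' := by
    refine ⟨0, ⟨contDiff_const, HasCompactSupport.zero, by simp⟩, ?_, fun i => ?_⟩
    · simpa using Lp.coeFn_zero ℝ 2 (volume.restrict Ω)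
    · filter_upwards [Lp.coeFn_zero ℝ 2 (volume.restrict Ω)] with x hx
      simpa [pderiv] using hx
  add_mem' := by
    rintro f g ⟨φ, ⟨h1, h2, h3⟩, h4, h5⟩ ⟨ψ, ⟨k1, k2, k3⟩, k4, k5⟩
    refine ⟨φ + ψ, ⟨h1.add k1, h2.add k2,
      (tsupport_add φ ψ).trans (union_subset h3 k3)⟩, ?_, fun i => ?_⟩
    · filter_upwards [Lp.coeFn_add (f none) (g none), h4, k4] with x hx h k
      simpa [h, k] using hx
    · filter_upwards [Lp.coeFn_add (f (some i)) (g (some i)), h5 i, k5 i] with x hx h k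
      have e : pderiv i (φ + ψ) x = pderiv i φ x + pderiv i ψ x := by
        unfold pderiv
        rw [fderiv_add (h1.differentiable (by simp) x) (k1.differentiable (by simp) x)]
        rfl
      simpa [h, k, e] using hx
  smul_mem' := by
    rintro c f ⟨φ, ⟨h1, h2, h3⟩, h4, h5⟩
    refine ⟨c • φ, ⟨h1.const_smul c, h2.smul_left (f := fun _ => c),
      (tsupport_smul_subset_right (fun _ => c) φ).trans h3⟩, ?_, fun i => ?_⟩
    · filter_upwards [Lp.coeFn_smul c (f none), h4] with x hx h
      simpa [h] using hx
    · filter_upwards [Lp.coeFn_smul c (f (some i)), h5 i] with x hx h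
      have e : pderiv i (c • φ) x = c * pderiv i φ x := by
        unfold pderiv
        rw [fderiv_const_smul (h1.differentiable (by simp) x)]
        rfl
      simpa [h, e] using hx

/-- `H¹₀(Ω)`: the closure of `C_c^∞(Ω)` in the `H¹` norm, each element being recorded together
with its weak gradient. -/
def H01 {n : ℕ} (Ω : Set (EuclideanSpace ℝ (Fin n))) : Submodule ℝ (Jet1 Ω) :=
  (testJets Ω).topologicalClosure

/-- The element of `L²(Ω)` underlying an element of `H¹₀(Ω)`. -/
def h01Fun {n : ℕ} {Ω : Set (EuclideanSpace ℝ (Fin n))} (v : H01 Ω) : L2 Ω :=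
  v.1 none

/-- The weak partial derivative `∂ᵢv` of `v ∈ H¹₀(Ω)`. -/
def h01Deriv {n : ℕ} {Ω : Set (EuclideanSpace ℝ (Fin n))} (v : H01 Ω) (i : Fin n) : L2 Ω :=
  v.1 (some i)

/-- Families of `L²(Ω)` functions indexed by the partial derivatives of order at most two:
`inl none` is for the function, `inl (some i)` for `∂ᵢ` and `inr (i, j)` for `∂ⱼ∂ᵢ`. The norm is
`(‖v‖² + ∑ᵢ ‖∂ᵢv‖² + ∑ᵢⱼ ‖∂ⱼ∂ᵢv‖²)^(1/2)`, the norm of `H²(Ω)`. -/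
abbrev Jet2 {n : ℕ} (Ω : Set (EuclideanSpace ℝ (Fin n))) : Type :=
  PiLp 2 (fun _ : Option (Fin n) ⊕ Fin n × Fin n => L2 Ω)

/-- The function and its first derivatives. -/
def Jet2.fst {n : ℕ} {Ω : Set (EuclideanSpace ℝ (Fin n))} (f : Jet2 Ω) : Jet1 Ω :=
  WithLp.toLp 2 fun a => f (Sum.inl a)

/-- The `i`-th derivative and its first derivatives. -/
def Jet2.deriv {n : ℕ} {Ω : Set (EuclideanSpace ℝ (Fin n))} (f : Jet2 Ω) (i : Fin n) : Jet1 Ω :=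
  WithLp.toLp 2 fun a => a.elim (f (Sum.inl (some i))) fun j => f (Sum.inr (i, j))

/-- `H²₀(Ω)`: the functions `v ∈ H¹₀(Ω) ∩ H²(Ω)` whose gradient vanishes on the boundary, that is,
`v ∈ H¹₀(Ω)` and `∂ᵢv ∈ H¹₀(Ω)` for all `i`, with the `H²` norm. -/
def H02 {n : ℕ} (Ω : Set (EuclideanSpace ℝ (Fin n))) : Submodule ℝ (Jet2 Ω) where
  carrier := {f | f.fst ∈ H01 Ω ∧ ∀ i, f.deriv i ∈ H01 Ω}
  zero_mem' := by
    have h1 : (0 : Jet2 Ω).fst = 0 := by ext a : 1; simp [Jet2.fst]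
    have h2 : ∀ i, (0 : Jet2 Ω).deriv i = 0 := by
      intro i; ext a : 1; cases a <;> simp [Jet2.deriv]
    exact ⟨h1 ▸ (H01 Ω).zero_mem, fun i => h2 i ▸ (H01 Ω).zero_mem⟩
  add_mem' := by
    rintro f g ⟨hf, hf'⟩ ⟨hg, hg'⟩
    have h1 : (f + g).fst = f.fst + g.fst := by ext a : 1; simp [Jet2.fst]
    have h2 : ∀ i, (f + g).deriv i = f.deriv i + g.deriv i := by
      intro i; ext a : 1; cases a <;> simp [Jet2.deriv]
    exact ⟨h1 ▸ (H01 Ω).add_mem hf hg, fun i => h2 i ▸ (H01 Ω).add_mem (hf' i) (hg' i)⟩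
  smul_mem' := by
    rintro c f ⟨hf, hf'⟩
    have h1 : (c • f).fst = c • f.fst := by ext a : 1; simp [Jet2.fst]
    have h2 : ∀ i, (c • f).deriv i = c • f.deriv i := by
      intro i; ext a : 1; cases a <;> simp [Jet2.deriv]
    exact ⟨h1 ▸ (H01 Ω).smul_mem c hf, fun i => h2 i ▸ (H01 Ω).smul_mem c (hf' i)⟩

/-- The element of `L²(Ω)` underlying an element of `H²₀(Ω)`. -/
def h02Fun {n : ℕ} {Ω : Set (EuclideanSpace ℝ (Fin n))} (v : H02 Ω) : L2 Ω :=
  v.1 (Sum.inl none)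

/-- The Poincaré constant: the least `c` with `‖v‖² ≤ c ‖∇v‖²` in `L²(Ω)` for all
`v ∈ H¹₀(Ω)`. -/
def poincareConstant {n : ℕ} (Ω : Set (EuclideanSpace ℝ (Fin n))) : ℝ≥0∞ :=
  sInf {c | ∀ v : H01 Ω, ‖h01Fun v‖ₑ ^ 2 ≤ c * ∑ i, ‖h01Deriv v i‖ₑ ^ 2}

/-- `Φ(U, u) = e^{-(U + u)} / ∫_Ω e^{-(U + u)}`. -/
def Phi {n : ℕ} (Ω : Set (EuclideanSpace ℝ (Fin n))) (U u : EuclideanSpace ℝ (Fin n) → ℝ)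
    (x : EuclideanSpace ℝ (Fin n)) : ℝ :=
  Real.exp (-(U x + u x)) / ∫ y in Ω, Real.exp (-(U y + u y))

/-- `U ∈ H¹₀(Ω)` is a weak solution of `-ΔU = Φ(U, u)` in `Ω`, `U = 0` on `∂Ω`. -/
def IsState {n : ℕ} (Ω : Set (EuclideanSpace ℝ (Fin n))) (u : L2 Ω) (U : H01 Ω) : Prop :=
  IntegrableOn (fun x => Real.exp (-(h01Fun U x + u x))) Ω ∧
  ∀ φ, IsTestFunction Ω φ →
    ∫ x in Ω, ∑ i, h01Deriv U i x * pderiv i φ x = ∫ x in Ω, Phi Ω (h01Fun U) u x * φ x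

open Classical in
/-- The control-to-state map `u ↦ U = S(u)`, with values in `L²(Ω)` (and the value `0` at those
`u` for which there is no state). -/
def controlToState {n : ℕ} (Ω : Set (EuclideanSpace ℝ (Fin n))) (u : L2 Ω) : L2 Ω :=
  if h : ∃ U : H01 Ω, IsState Ω u U then h01Fun h.choose else 0

/-- The admissible set `{v ∈ H¹₀(Ω) : M₁ ≤ v ≤ M₂ a.e. in Ω}`. -/
def boundedControls {n : ℕ} (Ω : Set (EuclideanSpace ℝ (Fin n))) (M₁ M₂ : ℝ) : Set (H01 Ω) :=
  {v | ∀ᵐ x ∂volume.restrict Ω, M₁ ≤ h01Fun v x ∧ h01Fun v x ≤ M₂}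

end PoissonBoltzmann

end

/-!
# Differentiability of the control-to-state map of a nonlocal Poisson–Boltzmann equation

The weak form of `-ΔU = Φ(U, u)` is the Euler–Lagrange equation of the energy
`½ ∫ |∇U|² + log ∫ e^{-(U + u)}` on `H¹₀(Ω)`. The second term is convex by Hölder's inequality (here:
convexity of `exp` applied to normalized Boltzmann factors), and the first is uniformly convex in
the `H¹` norm by the Poincaré inequality. All controls in question are bounded functions, and this
is what the analysis of the equation rests on.

*Existence* (`exists_isState`): the energy is bounded below by Jensen's inequality, a minimizing
sequence is Cauchy by uniform convexity (`energy_midpoint_le`), Fatou's lemma gives lower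
semicontinuity, and a minimizer may be varied along test functions, which are bounded.

*Uniqueness and stability.* The right hand side is positive, so a state is nonnegative
(`IsState.nonneg`); hence `e^{-(U + u)}` is bounded, every element of `H¹₀(Ω)` may be used as a
test function (`IsState.dirichletForm_eq`), and the monotonicity of the gradient of the convex term
(`integral_Phi_sub_mul_le`) controls the difference of two states. This yields uniqueness
(`IsState.unique`) and, once the normalization constant `∫ e^{-(U + u)}` is bounded below uniformly
on bounded sets of controls (`exists_le_integral_boltzmann`), Lipschitz dependence on the control
(`exists_norm_state_sub_le`).

*Differentiability* (`differentiableWithinAt_controlToState`): with `p = Φ(U, u)`, the derivative in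
direction `h` is the solution `w ∈ H¹₀(Ω)` of `-Δw + D w = -D h`, where `D k = p (k - ∫ p k)`. The
quadratic form of `D` is a variance, so the equation is solvable by the Lax–Milgram theorem. The
remainder `S(v) - S(u) - w` solves the same linear equation, with the second order Taylor remainder
of `Φ` on the right, whose `L²` norm is at most a constant times the square of the `L⁴` norm of the
increment of `U + u` (`GibbsPair.integral_sq_taylor_le`). Combined with the Lipschitz estimate and
an embedding `H¹₀(Ω) ⊂ L⁴(Ω)`, this makes the remainder quadratic in `v - u`.

*Embeddings.* In dimension one, `H¹₀(Ω) ⊂ L^∞(Ω)` by the fundamental theorem of calculus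
(`exists_ae_abs_h01Fun_le`). In dimensions two and three, `H¹₀(Ω) ⊂ L⁴(Ω)` by the
Gagliardo–Nirenberg–Sobolev inequality (`exists_eLpNorm_four_le`), and `H²₀(Ω) ⊂ L^∞(Ω)`
(`exists_ae_abs_h02Fun_le`): functions in `H²₀(Ω)`, extended by zero, have two weak derivatives in
`L²(ℝⁿ)`, so that their Fourier transform is integrable. None of this uses the regularity of the
boundary.
-/

noncomputable section

namespace PoissonBoltzmann

open Filter Topology

variable {n : ℕ} {Ω : Set (EuclideanSpace ℝ (Fin n))}

/-! ### The space `H¹₀(Ω)` -/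

/-- `h01Fun` as a continuous linear map. -/
def h01FunL (Ω : Set (EuclideanSpace ℝ (Fin n))) : H01 Ω →L[ℝ] L2 Ω :=
  (PiLp.proj 2 (fun _ : Option (Fin n) => L2 Ω) none) ∘L (H01 Ω).subtypeL

/-- `h01Deriv` as a continuous linear map. -/
def h01DerivL (Ω : Set (EuclideanSpace ℝ (Fin n))) (i : Fin n) : H01 Ω →L[ℝ] L2 Ω :=
  (PiLp.proj 2 (fun _ : Option (Fin n) => L2 Ω) (some i)) ∘L (H01 Ω).subtypeL

@[simp] lemma h01FunL_apply (v : H01 Ω) : h01FunL Ω v = h01Fun v := rfl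

@[simp] lemma h01DerivL_apply (v : H01 Ω) (i : Fin n) : h01DerivL Ω i v = h01Deriv v i := rfl

lemma h01Fun_sub (v w : H01 Ω) : h01Fun (v - w) = h01Fun v - h01Fun w := rfl

instance : CompleteSpace (H01 Ω) :=
  (Submodule.isClosed_topologicalClosure (testJets Ω)).completeSpace_coe

/-- The Dirichlet form `(v, w) ↦ ∫_Ω ∇v · ∇w`. -/
def dirichletForm (Ω : Set (EuclideanSpace ℝ (Fin n))) : H01 Ω →L[ℝ] H01 Ω →L[ℝ] ℝ :=
  ∑ i, (innerSL ℝ).bilinearComp (h01DerivL Ω i) (h01DerivL Ω i)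

lemma dirichletForm_apply (v w : H01 Ω) :
    dirichletForm Ω v w = ∑ i, inner ℝ (h01Deriv v i) (h01Deriv w i) := by
  simp [dirichletForm]

lemma dirichletForm_self (v : H01 Ω) : dirichletForm Ω v v = ∑ i, ‖h01Deriv v i‖ ^ 2 := by
  simp [dirichletForm_apply]

lemma dirichletForm_comm (v w : H01 Ω) : dirichletForm Ω v w = dirichletForm Ω w v := by
  simp [dirichletForm_apply, real_inner_comm]

lemma dirichletForm_self_nonneg (v : H01 Ω) : 0 ≤ dirichletForm Ω v v := by
  rw [dirichletForm_self]; positivity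

lemma norm_sq_eq (v : H01 Ω) : ‖v‖ ^ 2 = ‖h01Fun v‖ ^ 2 + dirichletForm Ω v v := by
  rw [dirichletForm_self, Submodule.coe_norm, PiLp.norm_sq_eq_of_L2, Fintype.sum_option]
  rfl

lemma norm_h01Fun_le (v : H01 Ω) : ‖h01Fun v‖ ≤ ‖v‖ := by
  have := norm_sq_eq v
  have := dirichletForm_self_nonneg v
  exact le_of_sq_le_sq (by linarith) (norm_nonneg _)

/-- The Poincaré inequality. -/
lemma norm_h01Fun_sq_le (hc : poincareConstant Ω < 4) (v : H01 Ω) :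
    ‖h01Fun v‖ ^ 2 ≤ 4 * dirichletForm Ω v v := by
  obtain ⟨c, hcm, hc4⟩ := sInf_lt_iff.1 hc
  have h : ‖h01Fun v‖ₑ ^ 2 ≤ 4 * ∑ i, ‖h01Deriv v i‖ₑ ^ 2 :=
    (hcm v).trans (by gcongr)
  have h2 := ENNReal.toReal_mono
    (ENNReal.mul_ne_top (by simp) (ENNReal.sum_ne_top.2 fun i _ => by finiteness)) h
  rw [ENNReal.toReal_mul, ENNReal.toReal_sum (by intros; finiteness)] at h2
  simpa [dirichletForm_self] using h2

/-- The Dirichlet form is coercive on `H¹₀(Ω)`. -/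
lemma norm_sq_le (hc : poincareConstant Ω < 4) (v : H01 Ω) :
    ‖v‖ ^ 2 ≤ 5 * dirichletForm Ω v v := by
  have := norm_sq_eq v
  have := norm_h01Fun_sq_le hc v
  linarith

/-- `v ∈ H¹₀(Ω)` is the class of the test function `φ`. -/
structure IsTest (v : H01 Ω) (φ : EuclideanSpace ℝ (Fin n) → ℝ) : Prop where
  test : IsTestFunction Ω φ
  fun_eq : h01Fun v =ᵐ[volume.restrict Ω] φ
  deriv_eq : ∀ i, h01Deriv v i =ᵐ[volume.restrict Ω] pderiv i φ

lemma IsTestFunction.continuous_pderiv {φ : EuclideanSpace ℝ (Fin n) → ℝ}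
    (h : IsTestFunction Ω φ) (i : Fin n) : Continuous (pderiv i φ) :=
  (h.1.continuous_fderiv (by simp)).clm_apply continuous_const

lemma IsTestFunction.hasCompactSupport_pderiv {φ : EuclideanSpace ℝ (Fin n) → ℝ}
    (h : IsTestFunction Ω φ) (i : Fin n) : HasCompactSupport (pderiv i φ) :=
  h.2.1.fderiv_apply (𝕜 := ℝ) _

lemma IsTestFunction.exists_isTest {φ : EuclideanSpace ℝ (Fin n) → ℝ}
    (h : IsTestFunction Ω φ) : ∃ v : H01 Ω, IsTest v φ := by
  have h0 : MemLp φ 2 (volume.restrict Ω) :=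
    (h.1.continuous.memLp_of_hasCompactSupport h.2.1).restrict _
  have h1 : ∀ i, MemLp (pderiv i φ) 2 (volume.restrict Ω) := fun i =>
    ((h.continuous_pderiv i).memLp_of_hasCompactSupport (h.hasCompactSupport_pderiv i)).restrict _
  let J : Jet1 Ω := WithLp.toLp 2 fun a => a.elim h0.toLp fun i => (h1 i).toLp
  have hJ : J ∈ testJets Ω := ⟨φ, h, h0.coeFn_toLp, fun i => (h1 i).coeFn_toLp⟩
  exact ⟨⟨J, (testJets Ω).le_topologicalClosure hJ⟩, h, h0.coeFn_toLp, fun i => (h1 i).coeFn_toLp⟩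

/-- Test functions are dense in `H¹₀(Ω)`. -/
lemma exists_seq_isTest (v : H01 Ω) :
    ∃ (w : ℕ → H01 Ω) (φ : ℕ → EuclideanSpace ℝ (Fin n) → ℝ),
      (∀ k, IsTest (w k) (φ k)) ∧ Tendsto w atTop (𝓝 v) := by
  have hv : (v : Jet1 Ω) ∈ closure (testJets Ω : Set (Jet1 Ω)) := v.2
  obtain ⟨f, hf, hlim⟩ := mem_closure_iff_seq_limit.1 hv
  choose φ hφ using hf
  refine ⟨fun k => ⟨f k, (testJets Ω).le_topologicalClosure ⟨φ k, hφ k⟩⟩, φ,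
    fun k => ⟨(hφ k).1, (hφ k).2.1, (hφ k).2.2⟩, ?_⟩
  exact tendsto_subtype_rng.2 hlim

lemma exists_subseq_tendsto_ae {α : Type*} [MeasurableSpace α] {μ : Measure α}
    {f : ℕ → Lp ℝ 2 μ} {g : Lp ℝ 2 μ} (h : Tendsto f atTop (𝓝 g)) :
    ∃ ns : ℕ → ℕ, StrictMono ns ∧ ∀ᵐ x ∂μ, Tendsto (fun k => f (ns k) x) atTop (𝓝 (g x)) :=
  (tendstoInMeasure_of_tendsto_Lp h).exists_seq_tendsto_ae

lemma real_inner_Lp_eq {α : Type*} [MeasurableSpace α] {μ : Measure α} (f g : Lp ℝ 2 μ) :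
    inner ℝ f g = ∫ x, f x * g x ∂μ := by
  simp [L2.inner_def, mul_comm]

/-- Products of boundedly a.e. convergent multipliers with a convergent sequence of `L²`
converge in `L²`. -/
lemma tendsto_mul_Lp {α : Type*} [MeasurableSpace α] {μ : Measure α}
    {g : ℕ → α → ℝ} {g' : α → ℝ} {C : ℝ}
    (hb : ∀ k x, |g k x| ≤ C) (hm : ∀ k, AEStronglyMeasurable (g k) μ)
    (hm' : AEStronglyMeasurable g' μ)
    (hlim : ∀ᵐ x ∂μ, Tendsto (fun k => g k x) atTop (𝓝 (g' x)))
    {F : ℕ → Lp ℝ 2 μ} {F' : Lp ℝ 2 μ} (hF : Tendsto F atTop (𝓝 F'))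
    {H : ℕ → Lp ℝ 2 μ} (hH : ∀ k, H k =ᵐ[μ] fun x => g k x * F k x) :
    ∃ H' : Lp ℝ 2 μ, (H' =ᵐ[μ] fun x => g' x * F' x) ∧ Tendsto H atTop (𝓝 H') := by
  have hb' : ∀ᵐ x ∂μ, |g' x| ≤ C := by
    filter_upwards [hlim] with x hx
    exact le_of_tendsto hx.abs (Eventually.of_forall fun k => hb k x)
  have hmem : ∀ {h : α → ℝ} {D : ℝ} (G : Lp ℝ 2 μ), AEStronglyMeasurable h μ →
      (∀ᵐ x ∂μ, |h x| ≤ D) → MemLp (fun x => h x * G x) 2 μ := by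
    intro h D G hh hD
    refine (Lp.memLp G).of_le_mul (c := D) (hh.mul (Lp.aestronglyMeasurable G)) ?_
    filter_upwards [hD] with x hx
    rw [norm_mul]
    exact mul_le_mul_of_nonneg_right hx (norm_nonneg _)
  have hmem' := hmem F' hm' hb'
  refine ⟨hmem'.toLp, hmem'.coeFn_toLp, ?_⟩
  -- The difference is `g k (F k - F') + (g k - g') F'`; dominated convergence handles the second.
  have hd : ∀ k, MemLp (fun x => (g k x - g' x) * F' x) 2 μ := fun k =>
    hmem (D := 2 * C) F' ((hm k).sub hm') (by
      filter_upwards [hb'] with x hx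
      have := abs_sub (g k x) (g' x)
      linarith [hb k x])
  have hdlim : Tendsto (fun k => ‖(hd k).toLp‖ ^ 2) atTop (𝓝 0) := by
    have e : ∀ k, ‖(hd k).toLp‖ ^ 2 = ∫ x, ((g k x - g' x) * F' x) ^ 2 ∂μ := by
      intro k
      rw [← real_inner_self_eq_norm_sq, real_inner_Lp_eq]
      refine integral_congr_ae ?_
      filter_upwards [(hd k).coeFn_toLp] with x hx
      rw [hx, sq]
    simp_rw [e]
    rw [show (0 : ℝ) = ∫ _ : α, (0 : ℝ) ∂μ by simp]
    refine tendsto_integral_of_dominated_convergence (fun x => (2 * C) ^ 2 * F' x ^ 2)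
      (fun k => (hd k).1.pow 2) (((Lp.memLp F').integrable_sq).const_mul _) (fun k => ?_) ?_
    · filter_upwards [hb'] with x hx
      rw [Real.norm_of_nonneg (sq_nonneg _), mul_pow]
      have := abs_sub (g k x) (g' x)
      gcongr ?_ * _
      exact sq_le_sq' (by linarith [hb k x, neg_abs_le (g k x - g' x)])
        (by linarith [hb k x, le_abs_self (g k x - g' x)])
    · filter_upwards [hlim] with x hx
      have : Tendsto (fun k => ((g k x - g' x) * F' x) ^ 2) atTop
        (𝓝 (((g' x - g' x) * F' x) ^ 2)) := ((hx.sub_const _).mul_const _).pow 2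
      simpa using this
  have hdlim' : Tendsto (fun k => ‖(hd k).toLp‖) atTop (𝓝 0) := by
    have := hdlim.sqrt
    simpa [Real.sqrt_sq (norm_nonneg _)] using this
  rw [tendsto_iff_norm_sub_tendsto_zero]
  have hF0 := (tendsto_iff_norm_sub_tendsto_zero.1 hF).const_mul C
  have hsum := hF0.add hdlim'
  simp only [mul_zero, add_zero] at hsum
  refine squeeze_zero (fun _ => norm_nonneg _) (fun k => ?_) hsum
  have h1 : ‖H k - hmem'.toLp - (hd k).toLp‖ ≤ C * ‖F k - F'‖ := by
    refine Lp.norm_le_mul_norm_of_ae_le_mul ?_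
    filter_upwards [Lp.coeFn_sub (H k - hmem'.toLp) (hd k).toLp, Lp.coeFn_sub (H k) hmem'.toLp,
      (hd k).coeFn_toLp, hmem'.coeFn_toLp, hH k, Lp.coeFn_sub (F k) F'] with x h1 h2 h3 h4 h5 h6
    rw [h1, Pi.sub_apply, h2, Pi.sub_apply, h3, h4, h5, h6, Pi.sub_apply,
      show g k x * F k x - g' x * F' x - (g k x - g' x) * F' x = g k x * (F k x - F' x) by ring,
      norm_mul]
    exact mul_le_mul_of_nonneg_right (hb k x) (norm_nonneg _)
  have h2 := norm_sub_norm_le (H k - hmem'.toLp) ((hd k).toLp)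
  linarith

/-- The chain rule in `H¹₀(Ω)`, together with an approximation by test functions `η ∘ φ k`, which
satisfy the same pointwise bounds as `η`. -/
lemma exists_comp {η : ℝ → ℝ} (hη : ContDiff ℝ ∞ η) (h0 : η 0 = 0) {C : ℝ}
    (hC : ∀ t, |deriv η t| ≤ C) (v : H01 Ω) :
    ∃ (w : H01 Ω) (W : ℕ → H01 Ω) (φ : ℕ → EuclideanSpace ℝ (Fin n) → ℝ),
      (h01Fun w =ᵐ[volume.restrict Ω] fun x => η (h01Fun v x)) ∧
      (∀ i, h01Deriv w i =ᵐ[volume.restrict Ω] fun x => deriv η (h01Fun v x) * h01Deriv v i x) ∧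
      (∀ k, IsTest (W k) (η ∘ φ k)) ∧ Tendsto W atTop (𝓝 w) ∧
      ∀ᵐ x ∂volume.restrict Ω, Tendsto (fun k => η (φ k x)) atTop (𝓝 (η (h01Fun v x))) := by
  obtain ⟨f₀, φ₀, hf₀, hlim₀⟩ := exists_seq_isTest v
  obtain ⟨ns, hns, hae₀⟩ := exists_subseq_tendsto_ae
    (((h01FunL Ω).continuous.tendsto v).comp hlim₀)
  set f := fun k => f₀ (ns k) with hfdef
  set φ := fun k => φ₀ (ns k) with hφdef
  have hf : ∀ k, IsTest (f k) (φ k) := fun k => hf₀ _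
  have hlim : Tendsto f atTop (𝓝 v) := hlim₀.comp hns.tendsto_atTop
  have hae : ∀ᵐ x ∂volume.restrict Ω, Tendsto (fun k => φ k x) atTop (𝓝 (h01Fun v x)) := by
    filter_upwards [hae₀, ae_all_iff.2 fun k => (hf k).fun_eq] with x h1 h2
    refine h1.congr fun k => h2 k
  have hC0 : 0 ≤ C := (abs_nonneg _).trans (hC 0)
  have htest : ∀ k, IsTestFunction Ω (η ∘ φ k) := fun k =>
    ⟨hη.comp (hf k).test.1, (hf k).test.2.1.comp_left h0,
      (tsupport_comp_subset h0 _).trans (hf k).test.2.2⟩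
  have hpd : ∀ k i x, pderiv i (η ∘ φ k) x = deriv η (φ k x) * pderiv i (φ k) x := by
    intro k i x
    unfold pderiv
    rw [((hη.differentiable (by simp) (φ k x)).hasDerivAt.comp_hasFDerivAt x
      ((hf k).test.1.differentiable (by simp) x).hasFDerivAt).fderiv]
    simp
  choose W hW using fun k => (htest k).exists_isTest
  have hη' : Continuous (deriv η) := hη.continuous_deriv (by simp)
  have hlip : LipschitzWith C.toNNReal η :=
    lipschitzWith_of_nnnorm_deriv_le (hη.differentiable (by simp)) fun t => by
      rw [← NNReal.coe_le_coe, coe_nnnorm, Real.coe_toNNReal _ hC0]; exact hC t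
  have hmv : AEStronglyMeasurable (h01Fun v) (volume.restrict Ω) := Lp.aestronglyMeasurable _
  -- the function itself
  have hmem : MemLp (fun x => η (h01Fun v x)) 2 (volume.restrict Ω) :=
    hlip.comp_memLp h0 (Lp.memLp (h01Fun v))
  have hW0 : Tendsto (fun k => h01Fun (W k)) atTop (𝓝 hmem.toLp) := by
    rw [tendsto_iff_norm_sub_tendsto_zero]
    have h1 := (tendsto_iff_norm_sub_tendsto_zero.1
      (((h01FunL Ω).continuous.tendsto v).comp hlim)).const_mul C
    rw [mul_zero] at h1
    refine squeeze_zero (fun _ => norm_nonneg _) (fun k => ?_) h1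
    refine Lp.norm_le_mul_norm_of_ae_le_mul ?_
    filter_upwards [Lp.coeFn_sub (h01Fun (W k)) hmem.toLp, hmem.coeFn_toLp, (hW k).fun_eq,
      (hf k).fun_eq, Lp.coeFn_sub (h01Fun (f k)) (h01Fun v)] with x h1 h2 h3 h4 h5
    rw [h1, Pi.sub_apply, h2, h3]
    change _ ≤ C * ‖(h01Fun (f k) - h01Fun v : L2 Ω) x‖
    rw [h5, Pi.sub_apply, h4]
    have := hlip.dist_le_mul (φ k x) (h01Fun v x)
    rwa [Real.coe_toNNReal _ hC0, dist_eq_norm, dist_eq_norm] at this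
  -- the derivatives
  have hD : ∀ i, ∃ H : L2 Ω, (H =ᵐ[volume.restrict Ω]
      fun x => deriv η (h01Fun v x) * h01Deriv v i x) ∧
      Tendsto (fun k => h01Deriv (W k) i) atTop (𝓝 H) := by
    intro i
    refine tendsto_mul_Lp (g := fun k x => deriv η (φ k x)) (fun k x => hC _)
      (fun k => (hη'.comp (hf k).test.1.continuous).aestronglyMeasurable)
      (hη'.comp_aestronglyMeasurable hmv) ?_
      (((h01DerivL Ω i).continuous.tendsto v).comp hlim) (fun k => ?_)
    · filter_upwards [hae] with x hx
      exact (hη'.tendsto _).comp hx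
    · filter_upwards [(hW k).deriv_eq i, (hf k).deriv_eq i] with x h1 h2
      rw [h1, hpd]
      change _ = _ * h01Deriv (f k) i x
      rw [h2]
  choose H hH1 hH2 using hD
  let J : Jet1 Ω := WithLp.toLp 2 fun a => a.elim hmem.toLp H
  have hJ : Tendsto (fun k => (W k : Jet1 Ω)) atTop (𝓝 J) := by
    have : Tendsto (fun k => WithLp.ofLp (W k : Jet1 Ω)) atTop (𝓝 (WithLp.ofLp J)) := by
      rw [tendsto_pi_nhds]
      rintro (_ | i)
      · exact hW0
      · exact hH2 i
    exact ((PiLp.continuous_toLp 2 _).tendsto _).comp this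
  have hJm : J ∈ H01 Ω := (Submodule.isClosed_topologicalClosure (testJets Ω)).mem_of_tendsto hJ
    (Eventually.of_forall fun k => (W k).2)
  refine ⟨⟨J, hJm⟩, W, φ, hmem.coeFn_toLp, hH1, hW, tendsto_subtype_rng.2 hJ, ?_⟩
  filter_upwards [hae] with x hx
  exact (hη.continuous.tendsto _).comp hx

/-! ### Sign, weak formulation and uniqueness of states -/

lemma IsState.integral_exp_pos [NeZero (volume.restrict Ω)] {u : L2 Ω} {U : H01 Ω}
    (h : IsState Ω u U) : 0 < ∫ x in Ω, Real.exp (-(h01Fun U x + u x)) :=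
  MeasureTheory.integral_exp_pos h.1

lemma IsState.Phi_pos [NeZero (volume.restrict Ω)] {u : L2 Ω} {U : H01 Ω}
    (h : IsState Ω u U) (x : EuclideanSpace ℝ (Fin n)) : 0 < Phi Ω (h01Fun U) u x :=
  div_pos (Real.exp_pos _) h.integral_exp_pos

lemma IsState.integrable_Phi {u : L2 Ω} {U : H01 Ω} (h : IsState Ω u U) :
    IntegrableOn (Phi Ω (h01Fun U) u) Ω := h.1.div_const _

lemma IsState.integral_Phi [NeZero (volume.restrict Ω)] {u : L2 Ω} {U : H01 Ω}
    (h : IsState Ω u U) : ∫ x in Ω, Phi Ω (h01Fun U) u x = 1 := by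
  unfold Phi
  rw [integral_div, div_self h.integral_exp_pos.ne']

lemma IsTest.dirichletForm_eq {w : H01 Ω} {φ : EuclideanSpace ℝ (Fin n) → ℝ} (hw : IsTest w φ)
    (U : H01 Ω) :
    dirichletForm Ω U w = ∫ x in Ω, ∑ i, h01Deriv U i x * pderiv i φ x := by
  have hint : ∀ i, Integrable (fun x => h01Deriv U i x * pderiv i φ x) (volume.restrict Ω) := by
    intro i
    refine ((Lp.memLp (h01Deriv U i)).integrable_mul (Lp.memLp (h01Deriv w i))).congr ?_
    filter_upwards [hw.deriv_eq i] with x hx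
    simp [hx]
  rw [dirichletForm_apply, integral_finsetSum _ fun i _ => hint i]
  refine Finset.sum_congr rfl fun i _ => ?_
  rw [real_inner_Lp_eq]
  refine integral_congr_ae ?_
  filter_upwards [hw.deriv_eq i] with x hx
  rw [hx]

lemma IsState.dirichletForm_of_isTest {u : L2 Ω} {U : H01 Ω} (h : IsState Ω u U)
    {w : H01 Ω} {φ : EuclideanSpace ℝ (Fin n) → ℝ} (hw : IsTest w φ) :
    dirichletForm Ω U w = ∫ x in Ω, Phi Ω (h01Fun U) u x * φ x := by
  rw [hw.dirichletForm_eq, h.2 φ hw.test]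

/-- A smooth, nondecreasing, bounded function with bounded derivative, negative on the negative
half-line and zero elsewhere. -/
lemma exists_smooth_negPart : ∃ (η : ℝ → ℝ) (C : ℝ), ContDiff ℝ ∞ η ∧ (∀ t, 0 ≤ t → η t = 0) ∧
    (∀ t < 0, η t < 0) ∧ (∀ t, η t ≤ 0) ∧ (∀ t, -1 ≤ η t) ∧
    (∀ t, 0 ≤ deriv η t) ∧ ∀ t, |deriv η t| ≤ C := by
  have hs : ContDiff ℝ ∞ (fun t : ℝ => -Real.smoothTransition (-t)) :=
    (Real.smoothTransition.contDiff.comp contDiff_neg).neg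
  have hd : ∀ t, t ∉ Icc (-1 : ℝ) 0 → deriv (fun t : ℝ => -Real.smoothTransition (-t)) t = 0 := by
    intro t ht
    have hloc : ∃ c : ℝ, (fun t : ℝ => -Real.smoothTransition (-t)) =ᶠ[𝓝 t] fun _ => c := by
      rw [mem_Icc, not_and_or, not_le, not_le] at ht
      rcases ht with ht | ht
      · refine ⟨-1, ?_⟩
        filter_upwards [gt_mem_nhds ht] with s hs
        rw [Real.smoothTransition.one_of_one_le (by linarith)]
      · refine ⟨0, ?_⟩
        filter_upwards [lt_mem_nhds ht] with s hs
        rw [Real.smoothTransition.zero_of_nonpos (by linarith), neg_zero]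
    obtain ⟨c, hc⟩ := hloc
    rw [hc.deriv_eq, deriv_const]
  obtain ⟨C, hC⟩ := isCompact_Icc.exists_bound_of_continuousOn (s := Icc (-1 : ℝ) 0)
    (hs.continuous_deriv (by simp)).continuousOn
  refine ⟨_, max C 0, hs, fun t ht => ?_, fun t ht => ?_, fun t => ?_, fun t => ?_, fun t => ?_,
    fun t => ?_⟩
  · simp [Real.smoothTransition.zero_of_nonpos (show -t ≤ 0 by linarith)]
  · simpa using Real.smoothTransition.pos_of_pos (show 0 < -t by linarith)
  · simpa using Real.smoothTransition.nonneg (-t)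
  · simpa using Real.smoothTransition.le_one (-t)
  · exact Monotone.deriv_nonneg fun a b hab =>
      neg_le_neg (Real.smoothTransition.monotone (neg_le_neg hab))
  · by_cases ht : t ∈ Icc (-1 : ℝ) 0
    · exact (hC t ht).trans (le_max_left _ _)
    · rw [hd t ht, abs_zero]; exact le_max_right _ _

/-- States are nonnegative: a smooth substitute for the negative part of `U` is an admissible
test function. -/
lemma IsState.nonneg [NeZero (volume.restrict Ω)] {u : L2 Ω} {U : H01 Ω} (h : IsState Ω u U) :
    ∀ᵐ x ∂volume.restrict Ω, 0 ≤ h01Fun U x := by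
  obtain ⟨η, C, hη, hpos, hneg, hnonpos, hge, hmono, hC⟩ := exists_smooth_negPart
  obtain ⟨w, W, φ, hw, hw', hW, hlim, hae⟩ := exists_comp hη (hpos 0 le_rfl) hC U
  have hη1 : ∀ t, |η t| ≤ 1 := fun t => abs_le.2 ⟨hge t, (hnonpos t).trans zero_le_one⟩
  have hPm : AEStronglyMeasurable (Phi Ω (h01Fun U) u) (volume.restrict Ω) := h.integrable_Phi.1
  have hUm : AEStronglyMeasurable (h01Fun U) (volume.restrict Ω) := Lp.aestronglyMeasurable _
  have h1 : dirichletForm Ω U w = ∫ x in Ω, Phi Ω (h01Fun U) u x * η (h01Fun U x) := by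
    refine tendsto_nhds_unique (((dirichletForm Ω U).continuous.tendsto w).comp hlim) ?_
    simp only [Function.comp_def, fun k => h.dirichletForm_of_isTest (hW k)]
    refine tendsto_integral_of_dominated_convergence (Phi Ω (h01Fun U) u)
      (fun k => hPm.mul (hW k).test.1.continuous.aestronglyMeasurable) h.integrable_Phi
      (fun k => Eventually.of_forall fun x => ?_) ?_
    · rw [norm_mul, Real.norm_of_nonneg (h.Phi_pos x).le]
      exact mul_le_of_le_one_right (h.Phi_pos x).le (hη1 _)
    · filter_upwards [hae] with x hx
      exact hx.const_mul _
  have h2 : 0 ≤ dirichletForm Ω U w := by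
    rw [dirichletForm_apply]
    refine Finset.sum_nonneg fun i _ => ?_
    rw [real_inner_Lp_eq]
    refine integral_nonneg_of_ae ?_
    filter_upwards [hw' i] with x hx
    rw [hx, show h01Deriv U i x * (deriv η (h01Fun U x) * h01Deriv U i x)
      = deriv η (h01Fun U x) * (h01Deriv U i x * h01Deriv U i x) by ring]
    exact mul_nonneg (hmono _) (mul_self_nonneg _)
  have hint : Integrable (fun x => -(Phi Ω (h01Fun U) u x * η (h01Fun U x)))
      (volume.restrict Ω) := by
    refine (Integrable.mono h.integrable_Phi (hPm.mul (hη.continuous.comp_aestronglyMeasurable hUm))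
      (Eventually.of_forall fun x => ?_)).neg
    rw [Pi.mul_apply, norm_mul]
    exact mul_le_of_le_one_right (norm_nonneg _) (hη1 _)
  have h3 : ∫ x in Ω, -(Phi Ω (h01Fun U) u x * η (h01Fun U x)) = 0 := by
    refine le_antisymm ?_ (integral_nonneg fun x => ?_)
    · rw [integral_neg, ← h1]; linarith
    · simpa using mul_nonpos_of_nonneg_of_nonpos (h.Phi_pos x).le (hnonpos _)
  rw [integral_eq_zero_iff_of_nonneg (fun x => by
    simpa using mul_nonpos_of_nonneg_of_nonpos (h.Phi_pos x).le (hnonpos _)) hint] at h3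
  filter_upwards [h3] with x hx
  by_contra hlt
  have := mul_neg_of_pos_of_neg (h.Phi_pos x) (hneg _ (not_le.1 hlt))
  simp only [Pi.zero_apply, neg_eq_zero] at hx
  linarith

/-- The exponent `U + u` of a state is bounded below. -/
lemma IsState.neg_le_add [NeZero (volume.restrict Ω)] {u : L2 Ω} {U : H01 Ω} (h : IsState Ω u U)
    {M : ℝ} (hM : ∀ᵐ x ∂volume.restrict Ω, |u x| ≤ M) :
    ∀ᵐ x ∂volume.restrict Ω, -M ≤ h01Fun U x + u x := by
  filter_upwards [h.nonneg, hM] with x h1 h2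
  linarith [neg_le_of_abs_le h2]

lemma IsState.Phi_le [NeZero (volume.restrict Ω)] {u : L2 Ω} {U : H01 Ω} (h : IsState Ω u U)
    {M : ℝ} (hM : ∀ᵐ x ∂volume.restrict Ω, |u x| ≤ M) :
    ∀ᵐ x ∂volume.restrict Ω, Phi Ω (h01Fun U) u x ≤
      Real.exp M / ∫ x in Ω, Real.exp (-(h01Fun U x + u x)) := by
  filter_upwards [h.neg_le_add hM] with x hx
  exact div_le_div_of_nonneg_right (Real.exp_le_exp.2 (by linarith)) h.integral_exp_pos.le

lemma IsState.memLp_Phi [IsFiniteMeasure (volume.restrict Ω)] [NeZero (volume.restrict Ω)]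
    {u : L2 Ω} {U : H01 Ω} (h : IsState Ω u U)
    {M : ℝ} (hM : ∀ᵐ x ∂volume.restrict Ω, |u x| ≤ M) (p : ℝ≥0∞) :
    MemLp (Phi Ω (h01Fun U) u) p (volume.restrict Ω) := by
  refine MemLp.of_bound h.integrable_Phi.1
    (Real.exp M / ∫ x in Ω, Real.exp (-(h01Fun U x + u x))) ?_
  filter_upwards [h.Phi_le hM] with x hx
  rwa [Real.norm_of_nonneg (h.Phi_pos x).le]

/-- For a bounded control the right hand side is bounded, so that every element of `H¹₀(Ω)` is an
admissible test function. -/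
lemma IsState.dirichletForm_eq [IsFiniteMeasure (volume.restrict Ω)] [NeZero (volume.restrict Ω)]
    {u : L2 Ω} {U : H01 Ω} (h : IsState Ω u U)
    {M : ℝ} (hM : ∀ᵐ x ∂volume.restrict Ω, |u x| ≤ M) (w : H01 Ω) :
    dirichletForm Ω U w = ∫ x in Ω, Phi Ω (h01Fun U) u x * h01Fun w x := by
  obtain ⟨W, φ, hW, hlim⟩ := exists_seq_isTest w
  have hP := h.memLp_Phi hM 2
  have e : ∀ w : H01 Ω, ∫ x in Ω, Phi Ω (h01Fun U) u x * h01Fun w x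
      = inner ℝ hP.toLp (h01FunL Ω w) := by
    intro w
    rw [real_inner_Lp_eq]
    refine integral_congr_ae ?_
    filter_upwards [hP.coeFn_toLp] with x hx
    rw [hx]; rfl
  have h1 := ((dirichletForm Ω U).continuous.tendsto w).comp hlim
  have h2 := (((innerSL ℝ hP.toLp ∘L h01FunL Ω).continuous.tendsto w).comp hlim)
  rw [e]
  refine tendsto_nhds_unique h1 (h2.congr fun k => ?_)
  simp only [Function.comp_apply, ContinuousLinearMap.comp_apply, innerSL_apply_apply]
  rw [← e, h.dirichletForm_of_isTest (hW k)]
  refine integral_congr_ae ?_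
  filter_upwards [(hW k).fun_eq] with x hx
  rw [hx]

/-- The monotonicity of `U ↦ -Φ(U, u)`, the derivative of the convex functional
`U ↦ log ∫ e^{-(U + u)}`. -/
lemma integral_Phi_sub_mul_le [NeZero (volume.restrict Ω)]
    {u v : L2 Ω} {U V : H01 Ω} (hU : IsState Ω u U) (hV : IsState Ω v V)
    (hint : Integrable (fun x => (Phi Ω (h01Fun V) v x - Phi Ω (h01Fun U) u x) *
      ((h01Fun V x + v x) - (h01Fun U x + u x))) (volume.restrict Ω)) :
    ∫ x in Ω, (Phi Ω (h01Fun V) v x - Phi Ω (h01Fun U) u x) *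
      ((h01Fun V x + v x) - (h01Fun U x + u x)) ≤ 0 := by
  set A := ∫ x in Ω, Real.exp (-(h01Fun U x + u x)) with hA
  set B := ∫ x in Ω, Real.exp (-(h01Fun V x + v x)) with hB
  have hpA : ∀ x, Phi Ω (h01Fun U) u x = Real.exp (-(h01Fun U x + u x) - Real.log A) := fun x => by
    rw [Real.exp_sub, Real.exp_log hU.integral_exp_pos]; rfl
  have hpB : ∀ x, Phi Ω (h01Fun V) v x = Real.exp (-(h01Fun V x + v x) - Real.log B) := fun x => by
    rw [Real.exp_sub, Real.exp_log hV.integral_exp_pos]; rfl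
  have hi : Integrable (fun x => (Phi Ω (h01Fun V) v x - Phi Ω (h01Fun U) u x) *
      (Real.log B - Real.log A)) (volume.restrict Ω) :=
    (hV.integrable_Phi.sub hU.integrable_Phi).mul_const _
  have h0 : ∫ x in Ω, (Phi Ω (h01Fun V) v x - Phi Ω (h01Fun U) u x) *
      (Real.log B - Real.log A) = 0 := by
    rw [integral_mul_const, integral_sub hV.integrable_Phi hU.integrable_Phi, hV.integral_Phi,
      hU.integral_Phi]
    simp
  have hsum := integral_add hint hi
  rw [h0, add_zero] at hsum
  rw [← hsum]
  refine MeasureTheory.integral_nonpos_of_ae (Eventually.of_forall fun x => ?_)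
  simp only [Pi.zero_apply]
  rw [hpA, hpB]
  set s := -(h01Fun V x + v x) - Real.log B
  set t := -(h01Fun U x + u x) - Real.log A
  have : (Real.exp s - Real.exp t) * (h01Fun V x + v x - (h01Fun U x + u x)) +
      (Real.exp s - Real.exp t) * (Real.log B - Real.log A)
      = (Real.exp s - Real.exp t) * (t - s) := by
    simp only [s, t]; ring
  rw [this]
  rcases le_total s t with hst | hst
  · exact mul_nonpos_of_nonpos_of_nonneg (sub_nonpos.2 (Real.exp_le_exp.2 hst)) (sub_nonneg.2 hst)
  · exact mul_nonpos_of_nonneg_of_nonpos (sub_nonneg.2 (Real.exp_le_exp.2 hst)) (sub_nonpos.2 hst)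

lemma IsState.dirichletForm_sub [IsFiniteMeasure (volume.restrict Ω)]
    [NeZero (volume.restrict Ω)] {u v : L2 Ω} {U V : H01 Ω} (hU : IsState Ω u U)
    (hV : IsState Ω v V) {M : ℝ} (hu : ∀ᵐ x ∂volume.restrict Ω, |u x| ≤ M)
    (hv : ∀ᵐ x ∂volume.restrict Ω, |v x| ≤ M) (φ : H01 Ω) :
    dirichletForm Ω (V - U) φ =
      ∫ x in Ω, (Phi Ω (h01Fun V) v x - Phi Ω (h01Fun U) u x) * h01Fun φ x := by
  have i1 : Integrable (fun x => Phi Ω (h01Fun V) v x * h01Fun φ x)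
    (volume.restrict Ω) := (hV.memLp_Phi hv 2).integrable_mul (Lp.memLp _)
  have i2 : Integrable (fun x => Phi Ω (h01Fun U) u x * h01Fun φ x)
    (volume.restrict Ω) := (hU.memLp_Phi hu 2).integrable_mul (Lp.memLp _)
  have : dirichletForm Ω (V - U) φ = dirichletForm Ω V φ - dirichletForm Ω U φ := by
    rw [map_sub (dirichletForm Ω)]; rfl
  rw [this, hV.dirichletForm_eq hv, hU.dirichletForm_eq hu, ← integral_sub i1 i2]
  simp only [sub_mul]

/-- The energy of the difference of two states is controlled by the difference of the controls. -/
lemma dirichletForm_sub_self_le [IsFiniteMeasure (volume.restrict Ω)]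
    [NeZero (volume.restrict Ω)] {u v : L2 Ω} {U V : H01 Ω} (hU : IsState Ω u U)
    (hV : IsState Ω v V) {M : ℝ} (hu : ∀ᵐ x ∂volume.restrict Ω, |u x| ≤ M)
    (hv : ∀ᵐ x ∂volume.restrict Ω, |v x| ≤ M) :
    dirichletForm Ω (V - U) (V - U) ≤
      -∫ x in Ω, (Phi Ω (h01Fun V) v x - Phi Ω (h01Fun U) u x) * (v x - u x) := by
  have hPU := hU.memLp_Phi hu 2
  have hPV := hV.memLp_Phi hv 2
  have hd : MemLp (fun x => Phi Ω (h01Fun V) v x - Phi Ω (h01Fun U) u x) 2 (volume.restrict Ω) :=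
    hPV.sub hPU
  have hI1 : Integrable (fun x => (Phi Ω (h01Fun V) v x - Phi Ω (h01Fun U) u x) *
      h01Fun (V - U) x) (volume.restrict Ω) := hd.integrable_mul (Lp.memLp _)
  have hI2 : Integrable (fun x => (Phi Ω (h01Fun V) v x - Phi Ω (h01Fun U) u x) *
      (v x - u x)) (volume.restrict Ω) := hd.integrable_mul ((Lp.memLp v).sub (Lp.memLp u))
  have e1 := hU.dirichletForm_sub hV hu hv (V - U)
  have e2 : (fun x => (Phi Ω (h01Fun V) v x - Phi Ω (h01Fun U) u x) *
      ((h01Fun V x + v x) - (h01Fun U x + u x))) =ᵐ[volume.restrict Ω]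
      fun x => (Phi Ω (h01Fun V) v x - Phi Ω (h01Fun U) u x) * h01Fun (V - U) x +
        (Phi Ω (h01Fun V) v x - Phi Ω (h01Fun U) u x) * (v x - u x) := by
    filter_upwards [Lp.coeFn_sub (h01Fun V) (h01Fun U)] with x hx
    rw [h01Fun_sub, hx, Pi.sub_apply]
    ring
  have := integral_Phi_sub_mul_le hU hV ((hI1.add hI2).congr e2.symm)
  rw [integral_congr_ae e2, integral_add hI1 hI2, ← e1] at this
  linarith

lemma IsState.unique (hc : poincareConstant Ω < 4) [IsFiniteMeasure (volume.restrict Ω)]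
    [NeZero (volume.restrict Ω)] {u : L2 Ω} {U V : H01 Ω} (hU : IsState Ω u U)
    (hV : IsState Ω u V) {M : ℝ} (hu : ∀ᵐ x ∂volume.restrict Ω, |u x| ≤ M) : V = U := by
  have h1 := dirichletForm_sub_self_le hU hV hu hu
  simp only [sub_self, mul_zero, integral_zero, neg_zero] at h1
  have h2 := norm_sq_le hc (V - U)
  have h3 : ‖V - U‖ ^ 2 ≤ 0 := by linarith
  rw [← sub_eq_zero, ← norm_eq_zero]
  exact pow_eq_zero_iff (two_ne_zero) |>.1 (le_antisymm h3 (sq_nonneg _))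

/-! ### Existence of states by minimization of a convex energy -/

/-- Jensen's inequality for the exponential, on a finite measure space. -/
lemma log_measure_sub_le_log_integral_exp {α : Type*} [MeasurableSpace α] {μ : Measure α}
    [IsFiniteMeasure μ] [NeZero μ] {f : α → ℝ} (hf : Integrable f μ)
    (he : Integrable (fun x => Real.exp (-f x)) μ) :
    Real.log (μ.real univ) - (∫ x, f x ∂μ) / μ.real univ ≤
      Real.log (∫ x, Real.exp (-f x) ∂μ) := by
  have hm : 0 < μ.real univ := measureReal_univ_pos
  set m := μ.real univ with hmdef
  set T := (∫ x, f x ∂μ) / m with hT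
  have hi : Integrable (fun x => Real.exp (-T) * (1 - (f x - T))) μ :=
    ((integrable_const _).sub (hf.sub (integrable_const _))).const_mul _
  have h1 : Real.exp (-T) * m ≤ ∫ x, Real.exp (-f x) ∂μ := by
    have e : ∫ x, Real.exp (-T) * (1 - (f x - T)) ∂μ = Real.exp (-T) * m := by
      have hfT : Integrable (fun x => f x - T) μ := hf.sub (integrable_const _)
      rw [integral_const_mul, integral_sub (integrable_const _) hfT,
        integral_sub hf (integrable_const _)]
      simp only [integral_const, smul_eq_mul, mul_one]
      rw [← hmdef, hT]
      field_simp
      ring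
    rw [← e]
    refine integral_mono hi he fun x => ?_
    have := Real.add_one_le_exp (-(f x - T))
    calc Real.exp (-T) * (1 - (f x - T)) ≤ Real.exp (-T) * Real.exp (-(f x - T)) := by
          gcongr; linarith
      _ = Real.exp (-f x) := by rw [← Real.exp_add]; ring_nf
  have h2 := Real.log_le_log (by positivity) h1
  rw [Real.log_mul (Real.exp_pos _).ne' hm.ne', Real.log_exp] at h2
  linarith

/-- The Boltzmann factor `e^{-(U + u)}`. -/
def boltzmann (u : L2 Ω) (U : H01 Ω) (x : EuclideanSpace ℝ (Fin n)) : ℝ :=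
  Real.exp (-(h01Fun U x + u x))

/-- The convex energy `½ ∫ |∇U|² + log ∫ e^{-(U + u)}` whose critical points are the states. -/
def energy (u : L2 Ω) (U : H01 Ω) : ℝ :=
  dirichletForm Ω U U / 2 + Real.log (∫ x in Ω, boltzmann u U x)

lemma boltzmann_pos (u : L2 Ω) (U : H01 Ω) (x : EuclideanSpace ℝ (Fin n)) :
    0 < boltzmann u U x := Real.exp_pos _

lemma norm_boltzmann (u : L2 Ω) (U : H01 Ω) (x : EuclideanSpace ℝ (Fin n)) :
    ‖boltzmann u U x‖ = boltzmann u U x := Real.norm_of_nonneg (boltzmann_pos u U x).le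

lemma aestronglyMeasurable_boltzmann (u : L2 Ω) (U : H01 Ω) :
    AEStronglyMeasurable (boltzmann u U) (volume.restrict Ω) :=
  Real.continuous_exp.comp_aestronglyMeasurable
    ((Lp.aestronglyMeasurable _).add (Lp.aestronglyMeasurable _)).neg

lemma integral_boltzmann_pos [NeZero (volume.restrict Ω)] {u : L2 Ω} {U : H01 Ω}
    (h : IntegrableOn (boltzmann u U) Ω) : 0 < ∫ x in Ω, boltzmann u U x :=
  MeasureTheory.integral_exp_pos h

lemma exists_abs_integral_le_mul_norm [IsFiniteMeasure (volume.restrict Ω)] :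
    ∃ c : ℝ, ∀ f : L2 Ω, |∫ x in Ω, f x| ≤ c * ‖f‖ := by
  have h1 : MemLp (fun _ : EuclideanSpace ℝ (Fin n) => (1 : ℝ)) 2 (volume.restrict Ω) :=
    memLp_const 1
  refine ⟨‖h1.toLp‖, fun f => ?_⟩
  have : ∫ x in Ω, f x = inner ℝ h1.toLp f := by
    rw [real_inner_Lp_eq]
    refine integral_congr_ae ?_
    filter_upwards [h1.coeFn_toLp] with x hx
    rw [hx, one_mul]
  rw [this]
  exact abs_real_inner_le_norm _ _

lemma integrable_of_L2 [IsFiniteMeasure (volume.restrict Ω)] (f : L2 Ω) :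
    Integrable f (volume.restrict Ω) := (Lp.memLp f).integrable (by norm_num)

/-- Jensen's inequality bounds the nonlinear part of the energy from below. -/
lemma exists_le_log_integral_boltzmann [IsFiniteMeasure (volume.restrict Ω)]
    [NeZero (volume.restrict Ω)] :
    ∃ c : ℝ, ∀ (M : ℝ) (u : L2 Ω) (U : H01 Ω),
      (∀ᵐ x ∂volume.restrict Ω, |u x| ≤ M) → IntegrableOn (boltzmann u U) Ω →
      -(c * (1 + M + ‖h01Fun U‖)) ≤ Real.log (∫ x in Ω, boltzmann u U x) := by
  obtain ⟨c, hc⟩ := exists_abs_integral_le_mul_norm (Ω := Ω)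
  have hm : 0 < (volume.restrict Ω).real univ := measureReal_univ_pos
  set m := (volume.restrict Ω).real univ with hmdef
  refine ⟨|Real.log m| + |c| / m + 1, fun M u U hu hU => ?_⟩
  have h1 := log_measure_sub_le_log_integral_exp (μ := volume.restrict Ω)
    (f := fun x => h01Fun U x + u x) ((integrable_of_L2 _).add (integrable_of_L2 _)) hU
  rw [integral_add (integrable_of_L2 _) (integrable_of_L2 _), add_div] at h1
  have hM : 0 ≤ M := by
    obtain ⟨x, hx⟩ := hu.exists
    exact (abs_nonneg _).trans hx
  have h2 : (∫ x in Ω, u x) / m ≤ M := by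
    rw [div_le_iff₀ hm]
    calc ∫ x in Ω, u x ≤ ∫ _ in Ω, M := by
          refine integral_mono_ae (integrable_of_L2 _) (integrable_const _) ?_
          filter_upwards [hu] with x hx using (le_abs_self _).trans hx
      _ = M * m := by simp [hmdef, mul_comm]
  have h3 : (∫ x in Ω, h01Fun U x) / m ≤ |c| / m * ‖h01Fun U‖ := by
    rw [div_mul_eq_mul_div]
    gcongr
    exact (le_abs_self _).trans ((hc _).trans (by gcongr; exact le_abs_self _))
  have h4 := neg_abs_le (Real.log m)
  have h5 : 0 ≤ |c| / m := by positivity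
  have h6 := norm_nonneg (h01Fun U)
  have h7 := abs_nonneg (Real.log m)
  change _ ≤ Real.log (∫ x in Ω, Real.exp (-(h01Fun U x + u x)))
  nlinarith [mul_nonneg h5 hM, mul_nonneg h7 h6, mul_nonneg h7 hM]

/-- The energy is bounded below: its nonlinear part decreases at most linearly, and the Dirichlet
form grows quadratically by the Poincaré inequality. -/
lemma exists_le_energy (hc : poincareConstant Ω < 4) [IsFiniteMeasure (volume.restrict Ω)]
    [NeZero (volume.restrict Ω)] {u : L2 Ω} {M : ℝ} (hu : ∀ᵐ x ∂volume.restrict Ω, |u x| ≤ M) :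
    ∃ c : ℝ, ∀ U : H01 Ω, IntegrableOn (boltzmann u U) Ω → c ≤ energy u U := by
  obtain ⟨c, h⟩ := exists_le_log_integral_boltzmann (Ω := Ω)
  refine ⟨-(c * (1 + M)) - 2 * c ^ 2, fun U hU => ?_⟩
  have h1 := h M u U hu hU
  have h2 := norm_h01Fun_sq_le hc U
  unfold energy
  nlinarith [sq_nonneg (‖h01Fun U‖ - 4 * c)]

lemma coeFn_midpoint (U V : H01 Ω) : h01Fun ((1 / 2 : ℝ) • (U + V)) =ᵐ[volume.restrict Ω]
    fun x => (h01Fun U x + h01Fun V x) / 2 := by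
  have e : h01Fun ((1 / 2 : ℝ) • (U + V)) = (1 / 2 : ℝ) • (h01Fun U + h01Fun V) := rfl
  rw [e]
  filter_upwards [Lp.coeFn_smul (1 / 2 : ℝ) (h01Fun U + h01Fun V),
    Lp.coeFn_add (h01Fun U) (h01Fun V)] with x h1 h2
  rw [h1, Pi.smul_apply, h2, Pi.add_apply, smul_eq_mul]
  ring

/-- The energy is uniformly convex. -/
lemma energy_midpoint_le [NeZero (volume.restrict Ω)] {u : L2 Ω} {U V : H01 Ω}
    (hU : IntegrableOn (boltzmann u U) Ω) (hV : IntegrableOn (boltzmann u V) Ω) :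
    IntegrableOn (boltzmann u ((1 / 2 : ℝ) • (U + V))) Ω ∧
    energy u ((1 / 2 : ℝ) • (U + V)) ≤
      (energy u U + energy u V) / 2 - dirichletForm Ω (U - V) (U - V) / 8 := by
  set A := ∫ x in Ω, boltzmann u U x with hA
  set B := ∫ x in Ω, boltzmann u V x with hB
  have hApos : 0 < A := integral_boltzmann_pos hU
  have hBpos : 0 < B := integral_boltzmann_pos hV
  set W := (1 / 2 : ℝ) • (U + V) with hW
  set L := (Real.log A + Real.log B) / 2 with hL
  -- convexity of the exponential, applied to the normalized Boltzmann factors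
  have hpt : ∀ᵐ x ∂volume.restrict Ω,
      boltzmann u W x ≤ Real.exp L * ((boltzmann u U x / A + boltzmann u V x / B) / 2) := by
    filter_upwards [coeFn_midpoint U V] with x hx
    have e1 : boltzmann u U x / A = Real.exp (-(h01Fun U x + u x) - Real.log A) := by
      rw [Real.exp_sub, Real.exp_log hApos]; rfl
    have e2 : boltzmann u V x / B = Real.exp (-(h01Fun V x + u x) - Real.log B) := by
      rw [Real.exp_sub, Real.exp_log hBpos]; rfl
    have e3 : boltzmann u W x = Real.exp L * Real.exp
        ((1 / 2) * (-(h01Fun U x + u x) - Real.log A) +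
          (1 / 2) * (-(h01Fun V x + u x) - Real.log B)) := by
      rw [← Real.exp_add]
      unfold boltzmann
      rw [hW, hx]
      congr 1
      rw [hL]; ring
    rw [e1, e2, e3]
    gcongr
    have := convexOn_exp.2 (mem_univ (-(h01Fun U x + u x) - Real.log A))
      (mem_univ (-(h01Fun V x + u x) - Real.log B)) (show (0 : ℝ) ≤ 1 / 2 by norm_num)
      (show (0 : ℝ) ≤ 1 / 2 by norm_num) (by norm_num)
    simp only [smul_eq_mul] at this
    linarith
  have hi1 : Integrable (fun x => boltzmann u U x / A) (volume.restrict Ω) := hU.div_const _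
  have hi2 : Integrable (fun x => boltzmann u V x / B) (volume.restrict Ω) := hV.div_const _
  have hi : Integrable (fun x => Real.exp L * ((boltzmann u U x / A + boltzmann u V x / B) / 2))
      (volume.restrict Ω) := ((hi1.add hi2).div_const 2).const_mul _
  have hWi : IntegrableOn (boltzmann u W) Ω := by
    refine Integrable.mono' hi (aestronglyMeasurable_boltzmann u W) ?_
    filter_upwards [hpt] with x hx
    rwa [norm_boltzmann]
  refine ⟨hWi, ?_⟩
  have hle : ∫ x in Ω, boltzmann u W x ≤ Real.exp L := by
    refine (integral_mono_ae hWi hi hpt).trans_eq ?_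
    rw [integral_const_mul, integral_div, integral_add hi1 hi2, integral_div, integral_div,
      ← hA, ← hB, div_self hApos.ne', div_self hBpos.ne']
    norm_num
  have hlog : Real.log (∫ x in Ω, boltzmann u W x) ≤ L :=
    (Real.log_le_log (integral_boltzmann_pos hWi) hle).trans_eq (Real.log_exp L)
  have hD : dirichletForm Ω W W = (dirichletForm Ω U U + dirichletForm Ω V V) / 2 -
      dirichletForm Ω (U - V) (U - V) / 4 := by
    rw [hW]
    simp only [map_smul, map_add, map_sub, _root_.smul_apply,
      _root_.add_apply, _root_.sub_apply, smul_eq_mul,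
      dirichletForm_comm V U]
    ring
  unfold energy
  rw [hD, ← hA, ← hB]
  rw [hL] at hlog
  linarith

/-- Lower semicontinuity of the energy along strongly convergent sequences (Fatou's lemma). -/
lemma energy_le_of_tendsto [NeZero (volume.restrict Ω)] {u : L2 Ω} {W : ℕ → H01 Ω} {U : H01 Ω}
    (hW : ∀ k, IntegrableOn (boltzmann u (W k)) Ω) (hlim : Tendsto W atTop (𝓝 U)) {I : ℝ}
    (hI : Tendsto (fun k => energy u (W k)) atTop (𝓝 I)) :
    IntegrableOn (boltzmann u U) Ω ∧ energy u U ≤ I := by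
  obtain ⟨ns, hns, hae⟩ := exists_subseq_tendsto_ae
    (((h01FunL Ω).continuous.tendsto U).comp hlim)
  have hD : Tendsto (fun k => dirichletForm Ω (W k) (W k)) atTop (𝓝 (dirichletForm Ω U U)) :=
    (((dirichletForm Ω).continuous.clm_apply continuous_id).tendsto U).comp hlim
  have hlog : Tendsto (fun k => Real.exp (energy u (W (ns k)) -
      dirichletForm Ω (W (ns k)) (W (ns k)) / 2)) atTop
      (𝓝 (Real.exp (I - dirichletForm Ω U U / 2))) :=
    (Real.continuous_exp.tendsto _).comp
      ((hI.comp hns.tendsto_atTop).sub ((hD.comp hns.tendsto_atTop).div_const 2))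
  have hexp : ∀ k, Real.exp (energy u (W k) - dirichletForm Ω (W k) (W k) / 2) =
      ∫ x in Ω, boltzmann u (W k) x := fun k => by
    rw [energy, add_sub_cancel_left, Real.exp_log (integral_boltzmann_pos (hW k))]
  simp only [hexp] at hlog
  have hfatou : ∫⁻ x in Ω, ENNReal.ofReal (boltzmann u U x) ≤
      ENNReal.ofReal (Real.exp (I - dirichletForm Ω U U / 2)) := by
    have e : ∀ᵐ x ∂volume.restrict Ω, ENNReal.ofReal (boltzmann u U x) =
        liminf (fun k => ENNReal.ofReal (boltzmann u (W (ns k)) x)) atTop := by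
      filter_upwards [hae] with x hx
      refine (Tendsto.liminf_eq ?_).symm
      refine ENNReal.tendsto_ofReal ?_
      exact (Real.continuous_exp.tendsto _).comp (hx.add_const _).neg
    rw [lintegral_congr_ae e]
    refine (lintegral_liminf_le' fun k =>
      (aestronglyMeasurable_boltzmann u _).aemeasurable.ennreal_ofReal).trans_eq ?_
    refine Tendsto.liminf_eq ?_
    refine (ENNReal.tendsto_ofReal hlog).congr fun k => ?_
    exact ofReal_integral_eq_lintegral_ofReal (hW _)
      (Eventually.of_forall fun x => (boltzmann_pos _ _ x).le)
  have hint : IntegrableOn (boltzmann u U) Ω := by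
    refine ⟨aestronglyMeasurable_boltzmann u U, ?_⟩
    rw [hasFiniteIntegral_iff_ofReal (Eventually.of_forall fun x => (boltzmann_pos _ _ x).le)]
    exact hfatou.trans_lt ENNReal.ofReal_lt_top
  refine ⟨hint, ?_⟩
  rw [← ofReal_integral_eq_lintegral_ofReal hint
      (Eventually.of_forall fun x => (boltzmann_pos _ _ x).le),
    ENNReal.ofReal_le_ofReal_iff (Real.exp_pos _).le] at hfatou
  have := Real.log_le_log (integral_boltzmann_pos hint) hfatou
  rw [Real.log_exp] at this
  unfold energy
  linarith

/-- A minimizing sequence of the energy is a Cauchy sequence by uniform convexity. -/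
lemma exists_energy_minimizer (hc : poincareConstant Ω < 4)
    [IsFiniteMeasure (volume.restrict Ω)] [NeZero (volume.restrict Ω)] {u : L2 Ω} {M : ℝ}
    (hu : ∀ᵐ x ∂volume.restrict Ω, |u x| ≤ M) :
    ∃ U : H01 Ω, IntegrableOn (boltzmann u U) Ω ∧
      ∀ V : H01 Ω, IntegrableOn (boltzmann u V) Ω → energy u U ≤ energy u V := by
  obtain ⟨c, hclow⟩ := exists_le_energy hc hu
  set K : Set (H01 Ω) := {V | IntegrableOn (boltzmann u V) Ω} with hK
  have h0 : (0 : H01 Ω) ∈ K := by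
    refine Integrable.of_bound (aestronglyMeasurable_boltzmann u 0) (Real.exp M) ?_
    filter_upwards [hu, Lp.coeFn_zero ℝ 2 (volume.restrict Ω)] with x hx h0
    rw [norm_boltzmann]
    refine Real.exp_le_exp.2 ?_
    change -((0 : L2 Ω) x + u x) ≤ M
    rw [h0, Pi.zero_apply]
    linarith [neg_le_of_abs_le hx]
  set I := sInf (energy u '' K) with hI
  have hbdd : BddBelow (energy u '' K) := ⟨c, by rintro _ ⟨V, hV, rfl⟩; exact hclow V hV⟩
  have hIle : ∀ V ∈ K, I ≤ energy u V := fun V hV => csInf_le hbdd ⟨V, hV, rfl⟩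
  have hseq : ∀ k : ℕ, ∃ V ∈ K, energy u V < I + 1 / ((k : ℝ) + 1) := by
    intro k
    obtain ⟨_, ⟨V, hV, rfl⟩, hlt⟩ := exists_lt_of_csInf_lt (⟨_, 0, h0, rfl⟩ :
      (energy u '' K).Nonempty) (show I < I + 1 / ((k : ℝ) + 1) by
        have : 0 < 1 / ((k : ℝ) + 1) := by positivity
        linarith)
    exact ⟨V, hV, hlt⟩
  choose W hWK hWlt using hseq
  have hcau : CauchySeq W := by
    refine cauchySeq_of_le_tendsto_0 (fun N : ℕ => √(40 * (1 / ((N : ℝ) + 1))))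
      (fun k l N hk hl => ?_) ?_
    -- `‖W k - W l‖² ≤ 5 D` by coercivity, and `D / 8 ≤ 1 / (N + 1)` by uniform convexity
    · rw [dist_eq_norm]
      refine Real.le_sqrt_of_sq_le ((norm_sq_le hc _).trans ?_)
      obtain ⟨hm, hle⟩ := energy_midpoint_le (hWK k) (hWK l)
      have h1 := hIle _ hm
      have h2 := hWlt k
      have h3 := hWlt l
      have h4 : 1 / ((k : ℝ) + 1) ≤ 1 / ((N : ℝ) + 1) := by gcongr
      have h5 : 1 / ((l : ℝ) + 1) ≤ 1 / ((N : ℝ) + 1) := by gcongr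
      linarith
    · have := ((tendsto_one_div_add_atTop_nhds_zero_nat (𝕜 := ℝ)).const_mul 40).sqrt
      simpa using this
  obtain ⟨U, hU⟩ := cauchySeq_tendsto_of_complete hcau
  have hIlim : Tendsto (fun k => energy u (W k)) atTop (𝓝 I) := by
    refine tendsto_of_tendsto_of_tendsto_of_le_of_le tendsto_const_nhds ?_
      (fun k => hIle _ (hWK k)) (fun k => (hWlt k).le)
    simpa using (tendsto_one_div_add_atTop_nhds_zero_nat (𝕜 := ℝ)).const_add I
  obtain ⟨hUi, hUle⟩ := energy_le_of_tendsto hWK hU hIlim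
  exact ⟨U, hUi, fun V hV => hUle.trans (hIle V hV)⟩

/-- The Euler–Lagrange equation of a minimizer of the energy. -/
lemma isState_of_minimizer [NeZero (volume.restrict Ω)] {u : L2 Ω} {U : H01 Ω}
    (hU : IntegrableOn (boltzmann u U) Ω)
    (hmin : ∀ V : H01 Ω, IntegrableOn (boltzmann u V) Ω → energy u U ≤ energy u V) :
    IsState Ω u U := by
  refine ⟨hU, fun φ hφ => ?_⟩
  obtain ⟨w, hw⟩ := hφ.exists_isTest
  rw [← hw.dirichletForm_eq]
  obtain ⟨K, hK⟩ := hφ.2.1.exists_bound_of_continuous hφ.1.continuous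
  have hK0 : 0 ≤ K := (norm_nonneg _).trans (hK 0)
  set Z := ∫ x in Ω, boltzmann u U x with hZ
  have hZpos : 0 < Z := integral_boltzmann_pos hU
  have hφi : Integrable (fun x => boltzmann u U x * φ x) (volume.restrict Ω) :=
    Integrable.mul_bdd (c := K) hU hφ.1.continuous.aestronglyMeasurable
      (Eventually.of_forall hK)
  have hPhi : ∫ x in Ω, Phi Ω (h01Fun U) u x * φ x = (∫ x in Ω, boltzmann u U x * φ x) / Z := by
    rw [← integral_div]
    refine integral_congr_ae (Eventually.of_forall fun x => ?_)
    simp only [Phi, boltzmann, hZ]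
    ring
  set E := ∫ x in Ω, Phi Ω (h01Fun U) u x * φ x with hE
  have hEZ : ∫ x in Ω, boltzmann u U x * φ x = Z * E := by rw [hPhi]; field_simp
  -- second order expansion of the energy along the line `t ↦ U + t w`
  have key : ∀ t : ℝ, |t| ≤ 1 / (K + 1) →
      0 ≤ t * (dirichletForm Ω U w - E) + t ^ 2 * (dirichletForm Ω w w / 2 + K ^ 2) := by
    intro t ht
    have htφ : ∀ x, |t * φ x| ≤ 1 := fun x => by
      rw [abs_mul]
      calc |t| * |φ x| ≤ 1 / (K + 1) * K := by gcongr; exact hK x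
        _ ≤ 1 := by rw [div_mul_eq_mul_div, one_mul, div_le_one (by positivity)]; linarith
    have hcoe : h01Fun (U + t • w) =ᵐ[volume.restrict Ω] fun x => h01Fun U x + t * φ x := by
      have e : h01Fun (U + t • w) = h01Fun U + t • h01Fun w := rfl
      rw [e]
      filter_upwards [Lp.coeFn_add (h01Fun U) (t • h01Fun w), Lp.coeFn_smul t (h01Fun w),
        hw.fun_eq] with x h1 h2 h3
      rw [h1, Pi.add_apply, h2, Pi.smul_apply, h3, smul_eq_mul]
    have hpt : ∀ᵐ x ∂volume.restrict Ω, boltzmann u (U + t • w) x ≤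
        (1 + t ^ 2 * K ^ 2) * boltzmann u U x - t * (boltzmann u U x * φ x) := by
      filter_upwards [hcoe] with x hx
      have e1 : boltzmann u (U + t • w) x = boltzmann u U x * Real.exp (-(t * φ x)) := by
        unfold boltzmann
        rw [hx, ← Real.exp_add]; ring_nf
      have e2 : Real.exp (-(t * φ x)) ≤ 1 - t * φ x + t ^ 2 * K ^ 2 := by
        have h1 := Real.abs_exp_sub_one_sub_id_le (x := -(t * φ x)) (by simpa using htφ x)
        have h2 := (le_abs_self _).trans h1
        have h3 : (-(t * φ x)) ^ 2 ≤ t ^ 2 * K ^ 2 := by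
          rw [neg_sq, mul_pow]
          gcongr ?_ * ?_
          exact sq_le_sq.2 ((hK x).trans (le_abs_self K))
        linarith
      rw [e1]
      have := mul_le_mul_of_nonneg_left e2 (Real.exp_pos (-(h01Fun U x + u x))).le
      unfold boltzmann
      linarith
    have hi : Integrable (fun x => (1 + t ^ 2 * K ^ 2) * boltzmann u U x -
        t * (boltzmann u U x * φ x)) (volume.restrict Ω) :=
      (hU.const_mul _).sub (hφi.const_mul _)
    have hVi : IntegrableOn (boltzmann u (U + t • w)) Ω := by
      refine Integrable.mono' hi (aestronglyMeasurable_boltzmann u _) ?_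
      filter_upwards [hpt] with x hx
      rwa [norm_boltzmann]
    have hle : ∫ x in Ω, boltzmann u (U + t • w) x ≤ Z * (1 + (t ^ 2 * K ^ 2 - t * E)) := by
      refine (integral_mono_ae hVi hi hpt).trans_eq ?_
      rw [integral_sub (hU.const_mul _) (hφi.const_mul _), integral_const_mul,
        integral_const_mul, hEZ, ← hZ]
      ring
    have hVpos := integral_boltzmann_pos hVi
    have hfac : 0 < 1 + (t ^ 2 * K ^ 2 - t * E) := pos_of_mul_pos_right (hVpos.trans_le hle) hZpos.le
    have hlog : Real.log (∫ x in Ω, boltzmann u (U + t • w) x) ≤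
        Real.log Z + (t ^ 2 * K ^ 2 - t * E) := by
      refine (Real.log_le_log hVpos hle).trans ?_
      rw [Real.log_mul hZpos.ne' hfac.ne']
      have := Real.log_le_sub_one_of_pos hfac
      linarith
    have hm := hmin _ hVi
    have hD : dirichletForm Ω (U + t • w) (U + t • w) = dirichletForm Ω U U +
        2 * t * dirichletForm Ω U w + t ^ 2 * dirichletForm Ω w w := by
      simp only [map_smul, map_add, _root_.smul_apply,
        _root_.add_apply, smul_eq_mul, dirichletForm_comm w U]
      ring
    unfold energy at hm
    rw [hD, ← hZ] at hm
    linarith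
  have hder : HasDerivAt (fun t : ℝ => t * (dirichletForm Ω U w - E) +
      t ^ 2 * (dirichletForm Ω w w / 2 + K ^ 2)) (dirichletForm Ω U w - E) 0 := by
    have := ((hasDerivAt_id (0 : ℝ)).mul_const (dirichletForm Ω U w - E)).add
      (((hasDerivAt_id (0 : ℝ)).pow 2).mul_const (dirichletForm Ω w w / 2 + K ^ 2))
    simp only [id, Nat.cast_ofNat, one_mul, Nat.add_one_sub_one, pow_one, mul_one, mul_zero,
      zero_mul, add_zero] at this
    exact this
  have hlocmin : IsLocalMin (fun t : ℝ => t * (dirichletForm Ω U w - E) +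
      t ^ 2 * (dirichletForm Ω w w / 2 + K ^ 2)) 0 := by
    have : Metric.ball (0 : ℝ) (1 / (K + 1)) ∈ 𝓝 (0 : ℝ) :=
      Metric.ball_mem_nhds _ (by positivity)
    filter_upwards [this] with t ht
    have := key t (by simpa using (mem_ball_zero_iff.1 ht).le)
    simpa using this
  have := hlocmin.hasDerivAt_eq_zero hder
  linarith

theorem exists_isState (hc : poincareConstant Ω < 4) [IsFiniteMeasure (volume.restrict Ω)]
    [NeZero (volume.restrict Ω)] {u : L2 Ω} {M : ℝ} (hu : ∀ᵐ x ∂volume.restrict Ω, |u x| ≤ M) :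
    ∃ U : H01 Ω, IsState Ω u U := by
  obtain ⟨U, hU, hmin⟩ := exists_energy_minimizer hc hu
  exact ⟨U, isState_of_minimizer hU hmin⟩

/-! ### A lower bound for the normalization constant -/

/-- The normalization constant of a state is bounded below in terms of a bound for the control.
Testing the equation with `U` shows `∫ |∇U|² = ∫ Φ U`, which Jensen's inequality for the
probability density `Φ` bounds by `log ∫ e^{-u} - log ∫ e^{-(U + u)}`; this grows only linearly in
`U`. -/
lemma exists_le_integral_boltzmann (hc : poincareConstant Ω < 4)
    [IsFiniteMeasure (volume.restrict Ω)] [NeZero (volume.restrict Ω)] (M : ℝ) :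
    ∃ c > 0, ∀ (u : L2 Ω) (U : H01 Ω), (∀ᵐ x ∂volume.restrict Ω, |u x| ≤ M) →
      IsState Ω u U → c ≤ ∫ x in Ω, boltzmann u U x := by
  obtain ⟨c, hlow⟩ := exists_le_log_integral_boltzmann (Ω := Ω)
  have hm : 0 < (volume.restrict Ω).real univ := measureReal_univ_pos
  set m := (volume.restrict Ω).real univ with hmdef
  set R := 1 + |4 * (M + Real.log m + c * (1 + M))| + |4 * c| with hR
  refine ⟨Real.exp (-(|c| * (1 + |M| + R))), Real.exp_pos _, fun u U hu hU => ?_⟩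
  set A := ∫ x in Ω, boltzmann u U x with hA
  have hApos : 0 < A := integral_boltzmann_pos hU.1
  have hlogA : -(c * (1 + M + ‖h01Fun U‖)) ≤ Real.log A := hlow M u U hu hU.1
  set T := ∫ x in Ω, Phi Ω (h01Fun U) u x * h01Fun U x with hT
  have hD : dirichletForm Ω U U = T := hU.dirichletForm_eq hu U
  have hPU : Integrable (fun x => Phi Ω (h01Fun U) u x * h01Fun U x) (volume.restrict Ω) :=
    (hU.memLp_Phi hu 2).integrable_mul (Lp.memLp _)
  have hTle : T ≤ M + Real.log m - Real.log A := by
    have hi0 : Integrable (fun x => Phi Ω (h01Fun U) u x * h01Fun U x +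
        Phi Ω (h01Fun U) u x) (volume.restrict Ω) := hPU.add hU.integrable_Phi
    have hi : Integrable (fun x => Real.exp T * ((Phi Ω (h01Fun U) u x * h01Fun U x +
        Phi Ω (h01Fun U) u x) - T * Phi Ω (h01Fun U) u x)) (volume.restrict Ω) :=
      (hi0.sub (Integrable.const_mul hU.integrable_Phi T)).const_mul _
    have e : ∫ x in Ω, Real.exp T * ((Phi Ω (h01Fun U) u x * h01Fun U x +
        Phi Ω (h01Fun U) u x) - T * Phi Ω (h01Fun U) u x) = Real.exp T := by
      rw [integral_const_mul, integral_sub hi0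
        (Integrable.const_mul hU.integrable_Phi T), integral_add hPU hU.integrable_Phi,
        integral_const_mul, hU.integral_Phi, ← hT]
      ring
    have hle : Real.exp T ≤ ∫ _ in Ω, Real.exp M / A := by
      rw [← e]
      refine integral_mono_ae hi (integrable_const _) ?_
      filter_upwards [hu] with x hx
      have h1 := Real.add_one_le_exp (h01Fun U x - T)
      have h2 : Phi Ω (h01Fun U) u x * Real.exp (h01Fun U x) = Real.exp (-(u x)) / A := by
        change Real.exp (-(h01Fun U x + u x)) / A * _ = _
        rw [div_mul_eq_mul_div, ← Real.exp_add]
        ring_nf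
      calc Real.exp T * ((Phi Ω (h01Fun U) u x * h01Fun U x + Phi Ω (h01Fun U) u x) -
              T * Phi Ω (h01Fun U) u x)
          = Real.exp T * (Phi Ω (h01Fun U) u x * (h01Fun U x - T + 1)) := by ring
        _ ≤ Real.exp T * (Phi Ω (h01Fun U) u x * Real.exp (h01Fun U x - T)) := by
          have := hU.Phi_pos x
          gcongr
        _ = Phi Ω (h01Fun U) u x * Real.exp (h01Fun U x) := by
          rw [Real.exp_sub]
          field_simp
        _ = Real.exp (-(u x)) / A := h2
        _ ≤ Real.exp M / A := by
          gcongr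
          linarith [neg_le_of_abs_le hx]
    rw [integral_const, smul_eq_mul, ← hmdef] at hle
    have h3 := Real.log_le_log (Real.exp_pos T) hle
    rw [Real.log_exp, Real.log_mul hm.ne' (by positivity), Real.log_div (Real.exp_pos _).ne'
      hApos.ne', Real.log_exp] at h3
    linarith
  have hpoin := norm_h01Fun_sq_le hc U
  have hnn := norm_nonneg (h01Fun U)
  -- a quadratic inequality `‖U‖² ≤ a + b ‖U‖` bounds `‖U‖`
  have hUR : ‖h01Fun U‖ ≤ R := by
    have hq : ‖h01Fun U‖ ^ 2 ≤ 4 * (M + Real.log m + c * (1 + M)) + 4 * c * ‖h01Fun U‖ := by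
      nlinarith
    by_contra hlt
    have hlt := not_le.1 hlt
    have h1 := le_abs_self (4 * (M + Real.log m + c * (1 + M)))
    have h2 := mul_le_mul_of_nonneg_right (le_abs_self (4 * c)) hnn
    have h3 := abs_nonneg (4 * (M + Real.log m + c * (1 + M)))
    have h4 := abs_nonneg (4 * c)
    have h5 : R * ‖h01Fun U‖ ≤ ‖h01Fun U‖ ^ 2 := by nlinarith
    have h6 : 1 ≤ ‖h01Fun U‖ := by linarith
    have h7 := mul_le_mul_of_nonneg_left h6 h3
    rw [hR] at h5
    nlinarith
  have hM0 : 0 ≤ M := by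
    obtain ⟨x, hx⟩ := hu.exists
    exact (abs_nonneg _).trans hx
  rw [← Real.le_log_iff_exp_le hApos]
  refine le_trans (neg_le_neg ?_) hlogA
  calc c * (1 + M + ‖h01Fun U‖) ≤ |c| * (1 + M + ‖h01Fun U‖) := by
        gcongr; exact le_abs_self c
    _ ≤ |c| * (1 + |M| + R) := by
        gcongr; exact le_abs_self M

/-! ### Expansion of normalized Boltzmann densities -/

lemma abs_exp_neg_sub_le {M x y : ℝ} (hx : -M ≤ x) (hy : -M ≤ y) :
    |Real.exp (-y) - Real.exp (-x)| ≤ Real.exp M * |y - x| := by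
  have hxM : Real.exp (-x) ≤ Real.exp M := Real.exp_le_exp.2 (by linarith)
  have hyM : Real.exp (-y) ≤ Real.exp M := Real.exp_le_exp.2 (by linarith)
  have h1 : Real.exp (-x) - Real.exp (-y) ≤ Real.exp (-x) * (y - x) := by
    have := mul_le_mul_of_nonneg_left (Real.add_one_le_exp (-(y - x))) (Real.exp_pos (-x)).le
    rw [← Real.exp_add, show -x + -(y - x) = -y by ring] at this
    linarith
  have h2 : Real.exp (-y) - Real.exp (-x) ≤ Real.exp (-y) * (x - y) := by
    have := mul_le_mul_of_nonneg_left (Real.add_one_le_exp (-(x - y))) (Real.exp_pos (-y)).le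
    rw [← Real.exp_add, show -y + -(x - y) = -x by ring] at this
    linarith
  refine abs_le.2 ⟨?_, ?_⟩
  · have h3 : Real.exp (-x) * (y - x) ≤ Real.exp M * |y - x| :=
      (mul_le_mul_of_nonneg_left (le_abs_self _) (Real.exp_pos _).le).trans
        (mul_le_mul_of_nonneg_right hxM (abs_nonneg _))
    linarith
  · have h3 : Real.exp (-y) * (x - y) ≤ Real.exp M * |y - x| := by
      rw [abs_sub_comm]
      exact (mul_le_mul_of_nonneg_left (le_abs_self _) (Real.exp_pos _).le).trans
        (mul_le_mul_of_nonneg_right hyM (abs_nonneg _))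
    linarith

lemma abs_exp_neg_taylor_le {M x y : ℝ} (hx : -M ≤ x) (hy : -M ≤ y) :
    |Real.exp (-y) - Real.exp (-x) + Real.exp (-x) * (y - x)| ≤ Real.exp M * (y - x) ^ 2 := by
  have h1 : Real.exp (-x) - Real.exp (-y) ≤ Real.exp (-x) * (y - x) := by
    have := mul_le_mul_of_nonneg_left (Real.add_one_le_exp (-(y - x))) (Real.exp_pos (-x)).le
    rw [← Real.exp_add, show -x + -(y - x) = -y by ring] at this
    linarith
  have h2 : Real.exp (-y) - Real.exp (-x) ≤ Real.exp (-y) * (x - y) := by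
    have := mul_le_mul_of_nonneg_left (Real.add_one_le_exp (-(x - y))) (Real.exp_pos (-y)).le
    rw [← Real.exp_add, show -y + -(x - y) = -x by ring] at this
    linarith
  rw [abs_of_nonneg (by linarith)]
  have h3 := abs_exp_neg_sub_le hx hy
  calc _ ≤ (Real.exp (-x) - Real.exp (-y)) * (y - x) := by linarith
    _ ≤ |Real.exp (-y) - Real.exp (-x)| * |y - x| := by
      rw [abs_sub_comm, ← abs_mul]; exact le_abs_self _
    _ ≤ Real.exp M * |y - x| * |y - x| := by gcongr
    _ = Real.exp M * (y - x) ^ 2 := by rw [mul_assoc, ← abs_mul, ← sq, abs_sq]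

/-- The difference of two normalized quantities `b / B` and `a / A`. -/
lemma abs_div_sub_div_le {a b k A B L m N c : ℝ} (hc : 0 < c) (hA : c ≤ A) (hB : c ≤ B)
    (ha0 : 0 ≤ a) (ha : a ≤ L) (hAm : A ≤ L * m) (hba : |b - a| ≤ L * |k|)
    (hBA : |B - A| ≤ L * N) :
    |b / B - a / A| ≤ (L ^ 2 * m * |k| + L ^ 2 * N) / c ^ 2 := by
  have hA0 := hc.trans_le hA
  have hB0 := hc.trans_le hB
  have e : b / B - a / A = ((b - a) * A - a * (B - A)) / (A * B) := by
    field_simp; ring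
  rw [e, abs_div, abs_of_pos (mul_pos hA0 hB0)]
  have hL : 0 ≤ L := ha0.trans ha
  have h1 : |(b - a) * A - a * (B - A)| ≤ L ^ 2 * m * |k| + L ^ 2 * N := by
    refine (abs_sub _ _).trans ?_
    rw [abs_mul, abs_mul, abs_of_pos hA0, abs_of_nonneg ha0]
    have h2 : |b - a| * A ≤ L * |k| * (L * m) := by gcongr
    have h3 : a * |B - A| ≤ L * (L * N) := by gcongr
    linarith
  have h0 : 0 ≤ L ^ 2 * m * |k| + L ^ 2 * N := (abs_nonneg _).trans h1
  calc _ ≤ (L ^ 2 * m * |k| + L ^ 2 * N) / (A * B) := by gcongr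
    _ ≤ _ := by
      apply div_le_div_of_nonneg_left h0 (by positivity)
      rw [sq]; gcongr

/-- The remainder of the first order expansion of `b / B` about `a / A`, where `b ≈ a - a k` and
`B ≈ A - P`. -/
lemma abs_div_taylor_le {a b k A B P L m N Q c : ℝ} (hc : 0 < c) (hA : c ≤ A) (hB : c ≤ B)
    (ha0 : 0 ≤ a) (ha : a ≤ L) (hm : 0 ≤ m) (hAm : A ≤ L * m) (hN : 0 ≤ N) (hQ : 0 ≤ Q)
    (hρ : |b - a + a * k| ≤ L * k ^ 2) (hBA : |B - A| ≤ L * N) (hP : |P| ≤ L * N)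
    (hσ : |B - A + P| ≤ L * Q) :
    |b / B - a / A + a / A * (k - P / A)| ≤
      (L ^ 3 * (1 + m) / c ^ 3 + L ^ 2 * (1 + m) / c ^ 2) * (|k| * N + N ^ 2 + k ^ 2 + Q) := by
  have hA0 := hc.trans_le hA
  have hB0 := hc.trans_le hB
  have hL : 0 ≤ L := ha0.trans ha
  have e : b / B - a / A + a / A * (k - P / A) =
      (a * k * A - a * P) * (B - A) / (A * A * B) +
        ((b - a + a * k) * A - a * (B - A + P)) / (A * B) := by
    field_simp; ring
  rw [e]
  have h1 : |(a * k * A - a * P) * (B - A)| ≤ (L * |k| * (L * m) + L * (L * N)) * (L * N) := by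
    rw [abs_mul]
    gcongr
    refine (abs_sub _ _).trans ?_
    rw [abs_mul, abs_mul, abs_mul, abs_of_pos hA0, abs_of_nonneg ha0]
    gcongr
  have h2 : |(b - a + a * k) * A - a * (B - A + P)| ≤ L * k ^ 2 * (L * m) + L * (L * Q) := by
    refine (abs_sub _ _).trans ?_
    rw [abs_mul, abs_mul, abs_of_pos hA0, abs_of_nonneg ha0]
    gcongr
  have h3 : |(a * k * A - a * P) * (B - A) / (A * A * B)| ≤
      (L * |k| * (L * m) + L * (L * N)) * (L * N) / c ^ 3 := by
    rw [abs_div, abs_of_pos (by positivity : 0 < A * A * B)]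
    have : c ^ 3 ≤ A * A * B := by
      calc c ^ 3 = c * c * c := by ring
        _ ≤ A * A * B := by gcongr
    gcongr
  have h4 : |((b - a + a * k) * A - a * (B - A + P)) / (A * B)| ≤
      (L * k ^ 2 * (L * m) + L * (L * Q)) / c ^ 2 := by
    rw [abs_div, abs_of_pos (by positivity : 0 < A * B)]
    have : c ^ 2 ≤ A * B := by rw [sq]; gcongr
    gcongr
  refine (abs_add_le _ _).trans ((add_le_add h3 h4).trans ?_)
  have h5 : (L * |k| * (L * m) + L * (L * N)) * (L * N) ≤
      L ^ 3 * (1 + m) * (|k| * N + N ^ 2 + k ^ 2 + Q) := by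
    have : 0 ≤ L ^ 3 * (|k| * N + m * N ^ 2 + (1 + m) * (k ^ 2 + Q)) := by positivity
    linarith
  have h6 : L * k ^ 2 * (L * m) + L * (L * Q) ≤
      L ^ 2 * (1 + m) * (|k| * N + N ^ 2 + k ^ 2 + Q) := by
    have : 0 ≤ L ^ 2 * (k ^ 2 + m * Q + (1 + m) * (|k| * N + N ^ 2)) := by positivity
    linarith
  rw [add_mul (L ^ 3 * (1 + m) / c ^ 3), div_mul_eq_mul_div, div_mul_eq_mul_div]
  gcongr

section Measure

variable {α : Type*} [MeasurableSpace α] {μ : Measure α} [IsFiniteMeasure μ]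

lemma sq_integral_le_measure_mul [NeZero μ] {f : α → ℝ} (hf : MemLp f 2 μ) :
    (∫ x, f x ∂μ) ^ 2 ≤ μ.real univ * ∫ x, f x ^ 2 ∂μ := by
  have hm : 0 < μ.real univ := measureReal_univ_pos
  set m := μ.real univ with hmdef
  set F := ∫ x, f x ∂μ with hF
  have hfi : Integrable f μ := hf.integrable (by norm_num)
  have h0 : 0 ≤ ∫ x, (m * f x - F) ^ 2 ∂μ := integral_nonneg fun x => sq_nonneg _
  have e : ∫ x, (m * f x - F) ^ 2 ∂μ = m * (m * ∫ x, f x ^ 2 ∂μ - F ^ 2) := by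
    have e1 : ∀ x, (m * f x - F) ^ 2 = (m ^ 2 * f x ^ 2 - 2 * m * F * f x) + F ^ 2 :=
      fun x => by ring
    have i1 : Integrable (fun x => m ^ 2 * f x ^ 2) μ := hf.integrable_sq.const_mul _
    have i2 : Integrable (fun x => 2 * m * F * f x) μ := hfi.const_mul _
    have i3 : Integrable (fun x => m ^ 2 * f x ^ 2 - 2 * m * F * f x) μ := i1.sub i2
    simp_rw [e1]
    rw [integral_add i3 (integrable_const _), integral_sub i1 i2, integral_const_mul,
      integral_const_mul, integral_const, ← hF, ← hmdef, smul_eq_mul]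
    ring
  rw [e] at h0
  have := nonneg_of_mul_nonneg_right h0 hm
  linarith

/-- Data for comparing the Gibbs densities of two exponents `x` and `y`, bounded below by `-M` and
with normalization constants bounded below by `c`. -/
structure GibbsPair (μ : Measure α) (M c : ℝ) (x y : α → ℝ) : Prop where
  lower_left : ∀ᵐ s ∂μ, -M ≤ x s
  lower_right : ∀ᵐ s ∂μ, -M ≤ y s
  integrable_left : Integrable (fun s => Real.exp (-x s)) μ
  integrable_right : Integrable (fun s => Real.exp (-y s)) μ
  le_left : c ≤ ∫ s, Real.exp (-x s) ∂μ
  le_right : c ≤ ∫ s, Real.exp (-y s) ∂μ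
  memLp_sub : MemLp (fun s => y s - x s) 4 μ

namespace GibbsPair

variable {M c : ℝ} {x y : α → ℝ}

lemma memLp_two (h : GibbsPair μ M c x y) : MemLp (fun s => y s - x s) 2 μ :=
  h.memLp_sub.mono_exponent (by norm_num)

lemma integrable_sub (h : GibbsPair μ M c x y) : Integrable (fun s => y s - x s) μ :=
  h.memLp_two.integrable (by norm_num)

lemma integral_left_le (h : GibbsPair μ M c x y) :
    ∫ s, Real.exp (-x s) ∂μ ≤ Real.exp M * μ.real univ := by
  calc ∫ s, Real.exp (-x s) ∂μ ≤ ∫ _, Real.exp M ∂μ := by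
        refine integral_mono_ae h.integrable_left (integrable_const _) ?_
        filter_upwards [h.lower_left] with s hs
        exact Real.exp_le_exp.2 (by linarith)
    _ = Real.exp M * μ.real univ := by simp [mul_comm]

lemma abs_integral_sub_le (h : GibbsPair μ M c x y) :
    |∫ s, Real.exp (-y s) ∂μ - ∫ s, Real.exp (-x s) ∂μ| ≤
      Real.exp M * ∫ s, |y s - x s| ∂μ := by
  rw [← integral_sub h.integrable_right h.integrable_left, ← integral_const_mul]
  refine (abs_integral_le_integral_abs).trans (integral_mono_ae
    (h.integrable_right.sub h.integrable_left).abs (h.integrable_sub.abs.const_mul _) ?_)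
  filter_upwards [h.lower_left, h.lower_right] with s h1 h2
  exact abs_exp_neg_sub_le h1 h2

/-- The Gibbs density is Lipschitz in `L²`. -/
lemma integral_sq_sub_le [NeZero μ] (h : GibbsPair μ M c x y) (hc : 0 < c) :
    ∫ s, (Real.exp (-y s) / (∫ s, Real.exp (-y s) ∂μ) -
        Real.exp (-x s) / (∫ s, Real.exp (-x s) ∂μ)) ^ 2 ∂μ ≤
      4 * (Real.exp M ^ 2 * μ.real univ / c ^ 2) ^ 2 * ∫ s, (y s - x s) ^ 2 ∂μ := by
  set A := ∫ s, Real.exp (-x s) ∂μ with hA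
  set B := ∫ s, Real.exp (-y s) ∂μ with hB
  set m := μ.real univ with hm
  set N := ∫ s, |y s - x s| ∂μ with hN
  set Q := ∫ s, (y s - x s) ^ 2 ∂μ with hQ
  set L := Real.exp M with hL
  have hm0 : 0 < m := measureReal_univ_pos
  have hNQ : N ^ 2 ≤ m * Q := by
    have := sq_integral_le_measure_mul h.memLp_two.abs
    simpa only [Pi.abs_apply, sq_abs] using this
  have hpt : ∀ᵐ s ∂μ, (Real.exp (-y s) / B - Real.exp (-x s) / A) ^ 2 ≤
      2 * (L ^ 2 / c ^ 2) ^ 2 * (m ^ 2 * (y s - x s) ^ 2 + N ^ 2) := by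
    filter_upwards [h.lower_left, h.lower_right] with s h1 h2
    have h3 := abs_div_sub_div_le hc h.le_left h.le_right (Real.exp_pos (-x s)).le
      (Real.exp_le_exp.2 (by linarith)) h.integral_left_le (abs_exp_neg_sub_le h1 h2)
      h.abs_integral_sub_le
    have h4 := sq_le_sq' (by linarith [neg_abs_le (Real.exp (-y s) / B - Real.exp (-x s) / A)])
      ((le_abs_self _).trans h3)
    refine h4.trans ?_
    have e1 : (L ^ 2 * m * |y s - x s| + L ^ 2 * N) / c ^ 2 =
        L ^ 2 / c ^ 2 * (m * |y s - x s| + N) := by ring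
    rw [e1, mul_pow, ← sq_abs (y s - x s)]
    have := sq_nonneg (m * |y s - x s| - N)
    have h5 : (m * |y s - x s| + N) ^ 2 ≤ 2 * (m ^ 2 * |y s - x s| ^ 2 + N ^ 2) := by linarith
    have := mul_le_mul_of_nonneg_left h5 (sq_nonneg (L ^ 2 / c ^ 2))
    linarith
  have hi1 : Integrable (fun s => m ^ 2 * (y s - x s) ^ 2) μ :=
    h.memLp_two.integrable_sq.const_mul _
  have hi2 : Integrable (fun s => 2 * (L ^ 2 / c ^ 2) ^ 2 *
      (m ^ 2 * (y s - x s) ^ 2 + N ^ 2)) μ := (hi1.add (integrable_const _)).const_mul _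
  refine (integral_mono_of_nonneg (Eventually.of_forall fun s => sq_nonneg _) hi2 hpt).trans ?_
  rw [integral_const_mul, integral_add hi1 (integrable_const _), integral_const_mul,
    integral_const, ← hQ, ← hm, smul_eq_mul]
  have : m * N ^ 2 ≤ m * (m * Q) := by gcongr
  have h6 : m ^ 2 * Q + m * N ^ 2 ≤ m ^ 2 * (2 * Q) := by linarith
  calc _ ≤ 2 * (L ^ 2 / c ^ 2) ^ 2 * (m ^ 2 * (2 * Q)) := by gcongr
    _ = _ := by ring

/-- The first order expansion of the Gibbs density, with a remainder in `L²` that is quadratic in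
the `L⁴` norm of the increment. -/
lemma integral_sq_taylor_le [NeZero μ] (h : GibbsPair μ M c x y) (hc : 0 < c) :
    ∫ s, (Real.exp (-y s) / (∫ s, Real.exp (-y s) ∂μ) -
        Real.exp (-x s) / (∫ s, Real.exp (-x s) ∂μ) +
        Real.exp (-x s) / (∫ s, Real.exp (-x s) ∂μ) * ((y s - x s) -
          (∫ s, Real.exp (-x s) * (y s - x s) ∂μ) / (∫ s, Real.exp (-x s) ∂μ))) ^ 2 ∂μ ≤
      4 * (Real.exp M ^ 3 * (1 + μ.real univ) / c ^ 3 +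
        Real.exp M ^ 2 * (1 + μ.real univ) / c ^ 2) ^ 2 *
        (1 + 2 * μ.real univ ^ 2 + μ.real univ ^ 4) * ∫ s, (y s - x s) ^ 4 ∂μ := by
  set A := ∫ s, Real.exp (-x s) ∂μ with hA
  set B := ∫ s, Real.exp (-y s) ∂μ with hB
  set P := ∫ s, Real.exp (-x s) * (y s - x s) ∂μ with hP
  set m := μ.real univ with hm
  set N := ∫ s, |y s - x s| ∂μ with hN
  set Q := ∫ s, (y s - x s) ^ 2 ∂μ with hQ
  set R := ∫ s, (y s - x s) ^ 4 ∂μ with hR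
  set L := Real.exp M with hL
  set D := L ^ 3 * (1 + m) / c ^ 3 + L ^ 2 * (1 + m) / c ^ 2 with hD
  have hm0 : 0 < m := measureReal_univ_pos
  have hN0 : 0 ≤ N := integral_nonneg fun s => abs_nonneg _
  have hQ0 : 0 ≤ Q := integral_nonneg fun s => sq_nonneg _
  have hNQ : N ^ 2 ≤ m * Q := by
    have := sq_integral_le_measure_mul h.memLp_two.abs
    simpa only [Pi.abs_apply, sq_abs] using this
  have hk4 : MemLp (fun s => (y s - x s) ^ 2) 2 μ := by
    have := h.memLp_sub.norm_rpow_div 2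
    have e : (4 : ℝ≥0∞) / 2 = 2 := by
      rw [show (4 : ℝ≥0∞) = 2 * 2 by norm_num,
        ENNReal.mul_div_cancel_right (by norm_num) (by norm_num)]
    rw [e] at this
    simpa using this
  have hQR : Q ^ 2 ≤ m * R := by
    have := sq_integral_le_measure_mul hk4
    simpa only [← pow_mul] using this
  have hi4 : Integrable (fun s => (y s - x s) ^ 4) μ := by
    simpa only [← pow_mul] using hk4.integrable_sq
  have hxb : Integrable (fun s => Real.exp (-x s) * (y s - x s)) μ := by
    refine Integrable.bdd_mul (c := L) h.integrable_sub h.integrable_left.1 ?_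
    filter_upwards [h.lower_left] with s hs
    rw [Real.norm_of_nonneg (Real.exp_pos _).le]
    exact Real.exp_le_exp.2 (by linarith)
  have hPN : |P| ≤ L * N := by
    rw [hP, hN, ← integral_const_mul]
    refine (abs_integral_le_integral_abs).trans (integral_mono_ae hxb.abs
      (h.integrable_sub.abs.const_mul _) ?_)
    filter_upwards [h.lower_left] with s hs
    rw [abs_mul, abs_of_pos (Real.exp_pos _)]
    gcongr
    exact Real.exp_le_exp.2 (by linarith)
  have hσ : |B - A + P| ≤ L * Q := by
    have hd : Integrable (fun s => Real.exp (-y s) - Real.exp (-x s)) μ :=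
      h.integrable_right.sub h.integrable_left
    rw [hB, hA, hP, hQ, ← integral_sub h.integrable_right h.integrable_left,
      ← integral_add hd hxb, ← integral_const_mul]
    refine (abs_integral_le_integral_abs).trans (integral_mono_ae (hd.add hxb).abs
      (h.memLp_two.integrable_sq.const_mul _) ?_)
    filter_upwards [h.lower_left, h.lower_right] with s h1 h2
    exact abs_exp_neg_taylor_le h1 h2
  have hpt : ∀ᵐ s ∂μ, (Real.exp (-y s) / B - Real.exp (-x s) / A +
      Real.exp (-x s) / A * ((y s - x s) - P / A)) ^ 2 ≤
      4 * D ^ 2 * ((N ^ 2 * (y s - x s) ^ 2 + (y s - x s) ^ 4) + (N ^ 4 + Q ^ 2)) := by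
    filter_upwards [h.lower_left, h.lower_right] with s h1 h2
    have h3 := abs_div_taylor_le hc h.le_left h.le_right (Real.exp_pos (-x s)).le
      (Real.exp_le_exp.2 (by linarith)) hm0.le h.integral_left_le hN0 hQ0
      (abs_exp_neg_taylor_le h1 h2) h.abs_integral_sub_le hPN hσ
    have h4 := sq_le_sq' (by linarith [neg_abs_le (Real.exp (-y s) / B - Real.exp (-x s) / A +
      Real.exp (-x s) / A * ((y s - x s) - P / A))]) ((le_abs_self _).trans h3)
    refine h4.trans ?_
    rw [mul_pow]
    set k := y s - x s
    have h5 : (|k| * N + N ^ 2 + k ^ 2 + Q) ^ 2 ≤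
        4 * ((|k| * N) ^ 2 + (N ^ 2) ^ 2 + (k ^ 2) ^ 2 + Q ^ 2) := by
      linarith [sq_nonneg (|k| * N - N ^ 2), sq_nonneg (|k| * N - k ^ 2),
        sq_nonneg (|k| * N - Q), sq_nonneg (N ^ 2 - k ^ 2), sq_nonneg (N ^ 2 - Q),
        sq_nonneg (k ^ 2 - Q)]
    rw [mul_pow |k| N, sq_abs] at h5
    have := mul_le_mul_of_nonneg_left h5 (sq_nonneg D)
    linarith
  have hi1 : Integrable (fun s => N ^ 2 * (y s - x s) ^ 2) μ :=
    h.memLp_two.integrable_sq.const_mul _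
  have hi3 : Integrable (fun s => N ^ 2 * (y s - x s) ^ 2 + (y s - x s) ^ 4) μ := hi1.add hi4
  have hi2 : Integrable (fun s => 4 * D ^ 2 * ((N ^ 2 * (y s - x s) ^ 2 + (y s - x s) ^ 4) +
      (N ^ 4 + Q ^ 2))) μ := (hi3.add (integrable_const _)).const_mul _
  refine (integral_mono_of_nonneg (Eventually.of_forall fun s => sq_nonneg _) hi2 hpt).trans ?_
  rw [integral_const_mul, integral_add hi3 (integrable_const _), integral_add hi1 hi4,
    integral_const_mul, integral_const, ← hQ, ← hR, ← hm, smul_eq_mul, mul_assoc (4 * D ^ 2)]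
  gcongr
  have h6 : N ^ 2 * Q ≤ m ^ 2 * R := by
    calc N ^ 2 * Q ≤ m * Q * Q := by gcongr
      _ = m * Q ^ 2 := by ring
      _ ≤ m * (m * R) := by gcongr
      _ = m ^ 2 * R := by ring
  have h7 : N ^ 4 ≤ m ^ 3 * R := by
    calc N ^ 4 = (N ^ 2) ^ 2 := by ring
      _ ≤ (m * Q) ^ 2 := by gcongr
      _ = m ^ 2 * Q ^ 2 := by ring
      _ ≤ m ^ 2 * (m * R) := by gcongr
      _ = m ^ 3 * R := by ring
  have h8 := mul_le_mul_of_nonneg_left (add_le_add h7 hQR) hm0.le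
  linarith

end GibbsPair

end Measure

/-! ### The linearized equation -/

/-- Multiplication by a bounded function on `L²`. -/
lemma exists_mulL {α : Type*} [MeasurableSpace α] {μ : Measure α} {p : α → ℝ} {K : ℝ}
    (hp : AEStronglyMeasurable p μ) (hK : ∀ᵐ x ∂μ, |p x| ≤ K) :
    ∃ T : Lp ℝ 2 μ →L[ℝ] Lp ℝ 2 μ, ∀ f, T f =ᵐ[μ] fun x => p x * f x := by
  have hmem : ∀ f : Lp ℝ 2 μ, MemLp (fun x => p x * f x) 2 μ := fun f => by
    refine (Lp.memLp f).of_le_mul (c := K) (hp.mul (Lp.aestronglyMeasurable f)) ?_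
    filter_upwards [hK] with x hx
    rw [norm_mul]
    exact mul_le_mul_of_nonneg_right hx (norm_nonneg _)
  let T : Lp ℝ 2 μ →ₗ[ℝ] Lp ℝ 2 μ :=
    { toFun := fun f => (hmem f).toLp
      map_add' := fun f g => by
        refine Lp.ext ?_
        filter_upwards [(hmem (f + g)).coeFn_toLp, (hmem f).coeFn_toLp, (hmem g).coeFn_toLp,
          Lp.coeFn_add f g, Lp.coeFn_add (hmem f).toLp (hmem g).toLp] with x h1 h2 h3 h4 h5
        rw [h1, h5, Pi.add_apply, h2, h3, h4, Pi.add_apply, mul_add]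
      map_smul' := fun c f => by
        refine Lp.ext ?_
        filter_upwards [(hmem (c • f)).coeFn_toLp, (hmem f).coeFn_toLp,
          Lp.coeFn_smul c f, Lp.coeFn_smul c (hmem f).toLp] with x h1 h2 h3 h4
        simp only [RingHom.id_apply]
        rw [h1, h4, Pi.smul_apply, h2, h3, Pi.smul_apply, smul_eq_mul, smul_eq_mul]
        ring }
  refine ⟨T.mkContinuous K fun f => ?_, fun f => (hmem f).coeFn_toLp⟩
  refine Lp.norm_le_mul_norm_of_ae_le_mul ?_
  filter_upwards [(hmem f).coeFn_toLp, hK] with x h1 h2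
  change ‖((hmem f).toLp : Lp ℝ 2 μ) x‖ ≤ _
  rw [h1, norm_mul]
  exact mul_le_mul_of_nonneg_right h2 (norm_nonneg _)

/-- The derivative of `-Φ` with respect to the exponent: for a bounded probability density `p`,
the operator `k ↦ p (k - ∫ p k)` on `L²`. Its quadratic form is the variance of `k` under `p`. -/
lemma exists_covarianceL {α : Type*} [MeasurableSpace α] {μ : Measure α} [IsFiniteMeasure μ]
    {p : α → ℝ} {K : ℝ} (hp : Integrable p μ) (h0 : ∀ x, 0 ≤ p x) (hK : ∀ᵐ x ∂μ, p x ≤ K)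
    (h1 : ∫ x, p x ∂μ = 1) :
    ∃ D : Lp ℝ 2 μ →L[ℝ] Lp ℝ 2 μ,
      (∀ f, D f =ᵐ[μ] fun x => p x * (f x - ∫ y, p y * f y ∂μ)) ∧ ∀ f, 0 ≤ inner ℝ (D f) f := by
  have hK' : ∀ᵐ x ∂μ, |p x| ≤ K := by
    filter_upwards [hK] with x hx
    rwa [abs_of_nonneg (h0 x)]
  obtain ⟨T, hT⟩ := exists_mulL hp.1 hK'
  have hpL : MemLp p 2 μ := MemLp.of_bound hp.1 K hK'
  have hE : ∀ f : Lp ℝ 2 μ, inner ℝ hpL.toLp f = ∫ y, p y * f y ∂μ := fun f => by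
    rw [real_inner_Lp_eq]
    refine integral_congr_ae ?_
    filter_upwards [hpL.coeFn_toLp] with x hx
    rw [hx]
  have hD : ∀ f, (T - (innerSL ℝ hpL.toLp).smulRight hpL.toLp) f =ᵐ[μ]
      fun x => p x * (f x - ∫ y, p y * f y ∂μ) := fun f => by
    have e : (T - (innerSL ℝ hpL.toLp).smulRight hpL.toLp) f =
        T f - (∫ y, p y * f y ∂μ) • hpL.toLp := by
      rw [← hE]; rfl
    rw [e]
    filter_upwards [hT f, Lp.coeFn_sub (T f) ((∫ y, p y * f y ∂μ) • hpL.toLp),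
      Lp.coeFn_smul (∫ y, p y * f y ∂μ) hpL.toLp, hpL.coeFn_toLp] with x h1 h2 h3 h4
    rw [h2, Pi.sub_apply, h1, h3, Pi.smul_apply, h4, smul_eq_mul]
    ring
  refine ⟨_, hD, fun f => ?_⟩
  set E := ∫ y, p y * f y ∂μ with hEdef
  have hpf : Integrable (fun x => p x * f x) μ := hpL.integrable_mul (Lp.memLp f)
  have i2 : Integrable (fun x => E * (p x * f x - E * p x)) μ :=
    (hpf.sub (hp.const_mul E)).const_mul _
  have e2 : ∫ x, E * (p x * f x - E * p x) ∂μ = 0 := by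
    rw [integral_const_mul, integral_sub hpf (hp.const_mul E), integral_const_mul, h1, ← hEdef]
    ring
  have i1 : Integrable (fun x => p x * (f x - E) * f x) μ := by
    refine ((Lp.memLp ((T - (innerSL ℝ hpL.toLp).smulRight hpL.toLp) f)).integrable_mul
      (Lp.memLp f)).congr ?_
    filter_upwards [hD f] with x hx
    rw [Pi.mul_apply, hx]
  have e1 : inner ℝ ((T - (innerSL ℝ hpL.toLp).smulRight hpL.toLp) f) f =
      ∫ x, p x * (f x - E) * f x ∂μ := by
    rw [real_inner_Lp_eq]
    refine integral_congr_ae ?_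
    filter_upwards [hD f] with x hx
    rw [hx]
  have e3 : ∫ x, p x * (f x - E) * f x ∂μ =
      ∫ x, (p x * (f x - E) * f x - E * (p x * f x - E * p x)) ∂μ := by
    rw [integral_sub i1 i2, e2, sub_zero]
  rw [e1, e3]
  refine integral_nonneg fun x => ?_
  simp only [Pi.zero_apply]
  rw [show p x * (f x - E) * f x - E * (p x * f x - E * p x) = p x * (f x - E) ^ 2 by ring]
  exact mul_nonneg (h0 x) (sq_nonneg _)

/-- The solution operator of `-Δw + D w = f`, `w ∈ H¹₀(Ω)`, for a nonnegative operator `D` on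
`L²(Ω)` (Lax–Milgram). -/
lemma exists_linearized_solution (hc : poincareConstant Ω < 4) (D : L2 Ω →L[ℝ] L2 Ω)
    (hD : ∀ f, 0 ≤ inner ℝ (D f) f) :
    ∃ G : L2 Ω →L[ℝ] H01 Ω, ∀ f φ, dirichletForm Ω (G f) φ +
      inner ℝ (D (h01Fun (G f))) (h01Fun φ) = inner ℝ f (h01Fun φ) := by
  let B : H01 Ω →L[ℝ] H01 Ω →L[ℝ] ℝ := dirichletForm Ω +
    ((innerSL ℝ).bilinearComp (D ∘L h01FunL Ω) (h01FunL Ω) : H01 Ω →L[ℝ] H01 Ω →L[ℝ] ℝ)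
  have hB : ∀ v w, B v w = dirichletForm Ω v w + inner ℝ (D (h01Fun v)) (h01Fun w) := by
    intro v w
    simp [B]
  have hcoer : IsCoercive B := by
    refine ⟨1 / 5, by norm_num, fun v => ?_⟩
    rw [hB]
    have h1 := norm_sq_le hc v
    have h2 := hD (h01Fun v)
    nlinarith
  refine ⟨(hcoer.continuousLinearEquivOfBilin.symm : H01 Ω →L[ℝ] H01 Ω) ∘L
    ContinuousLinearMap.adjoint (h01FunL Ω), fun f φ => ?_⟩
  rw [← hB]
  simp only [ContinuousLinearMap.comp_apply, ContinuousLinearEquiv.coe_coe]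
  rw [← hcoer.continuousLinearEquivOfBilin_apply, ContinuousLinearEquiv.apply_symm_apply,
    ContinuousLinearMap.adjoint_inner_left]
  rfl

/-! ### Differentiability of the control-to-state map -/

lemma IsState.controlToState_eq (hc : poincareConstant Ω < 4) [IsFiniteMeasure (volume.restrict Ω)]
    [NeZero (volume.restrict Ω)] {u : L2 Ω} {U : H01 Ω} (hU : IsState Ω u U)
    {M : ℝ} (hu : ∀ᵐ x ∂volume.restrict Ω, |u x| ≤ M) : controlToState Ω u = h01Fun U := by
  have hex : ∃ U : H01 Ω, IsState Ω u U := ⟨U, hU⟩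
  rw [controlToState, dif_pos hex, hU.unique hc hex.choose_spec hu]

lemma coeFn_add_sub_add (u v : L2 Ω) (U V : H01 Ω) :
    (h01Fun (V - U) + (v - u) : L2 Ω) =ᵐ[volume.restrict Ω]
      fun x => (h01Fun V x + v x) - (h01Fun U x + u x) := by
  filter_upwards [Lp.coeFn_add (h01Fun (V - U)) (v - u), Lp.coeFn_sub v u,
    Lp.coeFn_sub (h01Fun V) (h01Fun U)] with x h1 h2 h3
  rw [h1, Pi.add_apply, h2, Pi.sub_apply, h01Fun_sub, h3, Pi.sub_apply]
  ring

lemma gibbsPair_of_isState [NeZero (volume.restrict Ω)] {u v : L2 Ω} {U V : H01 Ω} {M c : ℝ}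
    (hU : IsState Ω u U) (hV : IsState Ω v V) (hu : ∀ᵐ x ∂volume.restrict Ω, |u x| ≤ M)
    (hv : ∀ᵐ x ∂volume.restrict Ω, |v x| ≤ M) (hcU : c ≤ ∫ x in Ω, boltzmann u U x)
    (hcV : c ≤ ∫ x in Ω, boltzmann v V x)
    (hδ : MemLp (h01Fun (V - U)) 4 (volume.restrict Ω))
    (hh : MemLp (v - u : L2 Ω) 4 (volume.restrict Ω)) :
    GibbsPair (volume.restrict Ω) M c (fun x => h01Fun U x + u x)
      (fun x => h01Fun V x + v x) where
  lower_left := hU.neg_le_add hu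
  lower_right := hV.neg_le_add hv
  integrable_left := hU.1
  integrable_right := hV.1
  le_left := hcU
  le_right := hcV
  memLp_sub := by
    refine (memLp_congr_ae ?_).1 (hδ.add hh)
    filter_upwards [coeFn_add_sub_add u v U V, Lp.coeFn_add (h01Fun (V - U)) (v - u)] with x h1 h2
    rw [← h1, h2]

lemma norm_sq_toLp_eq {α : Type*} [MeasurableSpace α] {μ : Measure α} {f : Lp ℝ 2 μ} {g : α → ℝ}
    (h : f =ᵐ[μ] g) : ‖f‖ ^ 2 = ∫ x, g x ^ 2 ∂μ := by
  rw [← real_inner_self_eq_norm_sq, real_inner_Lp_eq]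
  refine integral_congr_ae ?_
  filter_upwards [h] with x hx
  rw [hx, sq]

/-- Lipschitz dependence of the state on the control, for uniformly bounded controls. -/
lemma exists_norm_state_sub_le (hc : poincareConstant Ω < 4) [IsFiniteMeasure (volume.restrict Ω)]
    [NeZero (volume.restrict Ω)] (M : ℝ)
    (hS : ∀ w : H01 Ω, MemLp (h01Fun w) 4 (volume.restrict Ω)) :
    ∃ K : ℝ, 0 ≤ K ∧ ∀ (u v : L2 Ω) (U V : H01 Ω), IsState Ω u U → IsState Ω v V →
      (∀ᵐ x ∂volume.restrict Ω, |u x| ≤ M) → (∀ᵐ x ∂volume.restrict Ω, |v x| ≤ M) →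
      MemLp (v - u : L2 Ω) 4 (volume.restrict Ω) → ‖V - U‖ ≤ K * ‖v - u‖ := by
  obtain ⟨c, hcpos, hcle⟩ := exists_le_integral_boltzmann hc M
  set C := 4 * (Real.exp M ^ 2 * (volume.restrict Ω).real univ / c ^ 2) ^ 2 with hC
  have hC0 : 0 ≤ C := by positivity
  refine ⟨5 * √C + 1, by positivity, fun u v U V hU hV hu hv hh => ?_⟩
  have hG := gibbsPair_of_isState hU hV hu hv (hcle u U hu hU) (hcle v V hv hV) (hS _) hh
  have hd : MemLp (fun x => Phi Ω (h01Fun V) v x - Phi Ω (h01Fun U) u x) 2 (volume.restrict Ω) :=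
    (hV.memLp_Phi hv 2).sub (hU.memLp_Phi hu 2)
  have h1 : ‖hd.toLp‖ ^ 2 ≤ C * ‖h01Fun (V - U) + (v - u)‖ ^ 2 := by
    rw [norm_sq_toLp_eq hd.coeFn_toLp, norm_sq_toLp_eq (coeFn_add_sub_add u v U V)]
    exact hG.integral_sq_sub_le hcpos
  have h2 : ‖hd.toLp‖ ≤ √C * (‖V - U‖ + ‖v - u‖) := by
    have h3 : ‖h01Fun (V - U) + (v - u)‖ ≤ ‖V - U‖ + ‖v - u‖ :=
      (norm_add_le _ _).trans (by gcongr; exact norm_h01Fun_le _)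
    refine le_of_sq_le_sq ?_ (by positivity)
    rw [mul_pow, Real.sq_sqrt hC0]
    exact h1.trans (by gcongr)
  have h4 : dirichletForm Ω (V - U) (V - U) ≤ ‖hd.toLp‖ * ‖v - u‖ := by
    refine (dirichletForm_sub_self_le hU hV hu hv).trans ?_
    have e : ∫ x in Ω, (Phi Ω (h01Fun V) v x - Phi Ω (h01Fun U) u x) * (v x - u x) =
        inner ℝ hd.toLp (v - u) := by
      rw [real_inner_Lp_eq]
      refine integral_congr_ae ?_
      filter_upwards [hd.coeFn_toLp, Lp.coeFn_sub v u] with x h1 h2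
      rw [h1, h2, Pi.sub_apply]
    rw [e]
    exact (neg_le_abs _).trans (abs_real_inner_le_norm _ _)
  have h5 : ‖V - U‖ ^ 2 ≤ 5 * √C * (‖V - U‖ + ‖v - u‖) * ‖v - u‖ := by
    have := norm_sq_le hc (V - U)
    have := mul_le_mul_of_nonneg_right h2 (norm_nonneg (v - u))
    linarith
  have hs := norm_nonneg (V - U)
  have ht := norm_nonneg (v - u)
  have hK : 0 ≤ 5 * √C := by positivity
  set s := ‖V - U‖
  set t := ‖v - u‖
  set K := 5 * √C
  -- `s² ≤ K (s + t) t` forces `s ≤ (K + 1) t`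
  by_contra hlt
  have hlt := not_le.1 hlt
  have h6 : 0 ≤ K * t := by positivity
  have h7 : t < s := by nlinarith
  nlinarith

lemma add_pow_four_le (a b : ℝ) : (a + b) ^ 4 ≤ 8 * (a ^ 4 + b ^ 4) := by
  have h1 : (a + b) ^ 2 ≤ 2 * (a ^ 2 + b ^ 2) := by linarith [sq_nonneg (a - b)]
  have h2 := pow_le_pow_left₀ (sq_nonneg (a + b)) h1 2
  linarith [sq_nonneg (a ^ 2 - b ^ 2)]

lemma integrable_pow_four {α : Type*} [MeasurableSpace α] {μ : Measure α} {f : α → ℝ}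
    (hf : MemLp f 4 μ) : Integrable (fun x => f x ^ 4) μ := by
  have := hf.integrable_norm_pow (by norm_num)
  simpa only [Real.norm_eq_abs, Nat.cast_ofNat, Even.pow_abs (show Even 4 by decide)] using this

/-- The difference between the increment of the state and the solution of the linearized equation
solves a linear equation whose right hand side is the remainder in the expansion of the Gibbs
density, and this is quadratic in the `L⁴` norm of the increment of the exponent. -/
lemma norm_sq_state_sub_linearized_le (hc : poincareConstant Ω < 4)
    [IsFiniteMeasure (volume.restrict Ω)] [NeZero (volume.restrict Ω)]
    {u v : L2 Ω} {U V : H01 Ω} {M c : ℝ} (hcpos : 0 < c) (hU : IsState Ω u U) (hV : IsState Ω v V)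
    (hu : ∀ᵐ x ∂volume.restrict Ω, |u x| ≤ M) (hv : ∀ᵐ x ∂volume.restrict Ω, |v x| ≤ M)
    (hpair : GibbsPair (volume.restrict Ω) M c (fun x => h01Fun U x + u x)
      (fun x => h01Fun V x + v x))
    {D : L2 Ω →L[ℝ] L2 Ω} (hD : ∀ f, D f =ᵐ[volume.restrict Ω] fun x => Phi Ω (h01Fun U) u x *
      (f x - ∫ y in Ω, Phi Ω (h01Fun U) u y * f y))
    (hDnn : ∀ f, 0 ≤ inner ℝ (D f) f) {w : H01 Ω}
    (hw : ∀ φ, dirichletForm Ω w φ + inner ℝ (D (h01Fun w)) (h01Fun φ) =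
      inner ℝ (-(D (v - u))) (h01Fun φ)) :
    ‖h01Fun (V - U - w)‖ ^ 2 ≤
      16 * (4 * (Real.exp M ^ 3 * (1 + (volume.restrict Ω).real univ) / c ^ 3 +
        Real.exp M ^ 2 * (1 + (volume.restrict Ω).real univ) / c ^ 2) ^ 2 *
        (1 + 2 * (volume.restrict Ω).real univ ^ 2 + (volume.restrict Ω).real univ ^ 4) *
        ∫ x in Ω, ((h01Fun V x + v x) - (h01Fun U x + u x)) ^ 4) := by
  have hd : MemLp (fun x => Phi Ω (h01Fun V) v x - Phi Ω (h01Fun U) u x) 2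
    (volume.restrict Ω) := (hV.memLp_Phi hv 2).sub (hU.memLp_Phi hu 2)
  have hk := coeFn_add_sub_add u v U V
  set k : L2 Ω := h01Fun (V - U) + (v - u) with hkdef
  set r : L2 Ω := hd.toLp + D k with hr
  -- the equation satisfied by the remainder
  have heq : ∀ φ : H01 Ω, dirichletForm Ω (V - U - w) φ +
      inner ℝ (D (h01Fun (V - U - w))) (h01Fun φ) = inner ℝ r (h01Fun φ) := by
    intro φ
    have e1 : dirichletForm Ω (V - U) φ = inner ℝ hd.toLp (h01Fun φ) := by
      rw [hU.dirichletForm_sub hV hu hv, real_inner_Lp_eq]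
      refine integral_congr_ae ?_
      filter_upwards [hd.coeFn_toLp] with x hx
      rw [hx]
    have e2 := hw φ
    have e3 : dirichletForm Ω (V - U - w) φ =
        dirichletForm Ω (V - U) φ - dirichletForm Ω w φ := by
      rw [map_sub (dirichletForm Ω)]; rfl
    have e4 : D (h01Fun (V - U - w)) = D (h01Fun (V - U)) - D (h01Fun w) := by
      rw [h01Fun_sub (V - U) w, map_sub]
    have e5 : D k = D (h01Fun (V - U)) + D (v - u) := by rw [hkdef, map_add]
    rw [e3, e1, hr, e4, e5, inner_sub_left, inner_add_left, inner_add_left]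
    rw [inner_neg_left] at e2
    linarith
  -- testing with the remainder itself, coercivity and Cauchy–Schwarz
  have hrle : ‖h01Fun (V - U - w)‖ ≤ 4 * ‖r‖ := by
    have h1 := heq (V - U - w)
    have h2 := hDnn (h01Fun (V - U - w))
    have h3 := norm_h01Fun_sq_le hc (V - U - w)
    have h4 := real_inner_le_norm r (h01Fun (V - U - w))
    have h5 := norm_nonneg (h01Fun (V - U - w))
    by_contra hlt
    have hlt := not_le.1 hlt
    nlinarith [norm_nonneg r]
  have hEk : (∫ y in Ω, Phi Ω (h01Fun U) u y * k y) =
      (∫ y in Ω, Real.exp (-(h01Fun U y + u y)) *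
        ((h01Fun V y + v y) - (h01Fun U y + u y))) /
        ∫ y in Ω, Real.exp (-(h01Fun U y + u y)) := by
    rw [← integral_div]
    refine integral_congr_ae ?_
    filter_upwards [hk] with x hx
    rw [hx, Phi]
    ring
  have hr2 := hpair.integral_sq_taylor_le hcpos
  have hrae : r =ᵐ[volume.restrict Ω] fun x => Phi Ω (h01Fun V) v x - Phi Ω (h01Fun U) u x +
      Phi Ω (h01Fun U) u x * (((h01Fun V x + v x) - (h01Fun U x + u x)) -
        (∫ y in Ω, Real.exp (-(h01Fun U y + u y)) *
        ((h01Fun V y + v y) - (h01Fun U y + u y))) /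
        ∫ y in Ω, Real.exp (-(h01Fun U y + u y))) := by
    filter_upwards [Lp.coeFn_add hd.toLp (D k), hd.coeFn_toLp, hD k, hk] with x h1 h2 h3 h4
    rw [hr, h1, Pi.add_apply, h2, h3, h4, hEk]
  have hr3 := (norm_sq_toLp_eq hrae).trans_le hr2
  calc ‖h01Fun (V - U - w)‖ ^ 2 ≤ (4 * ‖r‖) ^ 2 := by gcongr
    _ = 16 * ‖r‖ ^ 2 := by ring
    _ ≤ _ := by gcongr

/-- Differentiability of the control-to-state map along a continuous linear family of controls
that are locally bounded and whose `L⁴` norm is controlled by the norm of the parameter. -/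
theorem differentiableWithinAt_controlToState (hc : poincareConstant Ω < 4)
    [IsFiniteMeasure (volume.restrict Ω)] [NeZero (volume.restrict Ω)]
    {C₁ : ℝ} (hS : ∀ w : H01 Ω, MemLp (h01Fun w) 4 (volume.restrict Ω) ∧
      ∫ x in Ω, h01Fun w x ^ 4 ≤ C₁ * ‖w‖ ^ 4)
    {X : Type*} [NormedAddCommGroup X] [NormedSpace ℝ X] (j : X →L[ℝ] L2 Ω) {A : Set X} {u : X}
    (hu : u ∈ A) {M : ℝ} (hM : ∀ᶠ v in 𝓝[A] u, ∀ᵐ x ∂volume.restrict Ω, |j v x| ≤ M)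
    {C₂ : ℝ} (hj : ∀ v : X, MemLp (j v) 4 (volume.restrict Ω) ∧
      ∫ x in Ω, j v x ^ 4 ≤ C₂ * ‖v‖ ^ 4) :
    DifferentiableWithinAt ℝ (fun v => controlToState Ω (j v)) A u := by
  have huM := hM.self_of_nhdsWithin hu
  obtain ⟨U, hU⟩ := exists_isState hc huM
  obtain ⟨c, hcpos, hcle⟩ := exists_le_integral_boltzmann hc M
  obtain ⟨K, hK0, hK⟩ := exists_norm_state_sub_le hc M fun w => (hS w).1
  obtain ⟨D, hD, hDnn⟩ := exists_covarianceL (μ := volume.restrict Ω) hU.integrable_Phi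
    (fun x => (hU.Phi_pos x).le) (hU.Phi_le huM) hU.integral_Phi
  obtain ⟨G, hG⟩ := exists_linearized_solution hc D hDnn
  obtain ⟨C, hC0, hC⟩ : ∃ C : ℝ, 0 ≤ C ∧ C =
      4 * (Real.exp M ^ 3 * (1 + (volume.restrict Ω).real univ) / c ^ 3 +
        Real.exp M ^ 2 * (1 + (volume.restrict Ω).real univ) / c ^ 2) ^ 2 *
        (1 + 2 * (volume.restrict Ω).real univ ^ 2 + (volume.restrict Ω).real univ ^ 4) :=
    ⟨_, by positivity, rfl⟩
  have hC₁ : ∀ w : H01 Ω, ∫ x in Ω, h01Fun w x ^ 4 ≤ |C₁| * ‖w‖ ^ 4 := fun w =>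
    (hS w).2.trans (by gcongr; exact le_abs_self _)
  have hC₂ : ∀ v : X, ∫ x in Ω, j v x ^ 4 ≤ |C₂| * ‖v‖ ^ 4 := fun v =>
    (hj v).2.trans (by gcongr; exact le_abs_self _)
  obtain ⟨C', hC'0, hC'⟩ : ∃ C' : ℝ, 0 ≤ C' ∧
    C' = 16 * C * (8 * (|C₁| * (K * ‖j‖) ^ 4 + |C₂|)) := ⟨_, by positivity, rfl⟩
  -- the derivative: `h ↦ w`, where `-Δw + D w = -D h`
  let L : X →L[ℝ] L2 Ω := h01FunL Ω ∘L G ∘L (-D) ∘L j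
  have hLu : ∀ h : X, L h = h01Fun (G (-(D (j h)))) := fun h => rfl
  have key : ∀ᶠ v in 𝓝[A] u, ‖controlToState Ω (j v) - controlToState Ω (j u) - L (v - u)‖ ≤
      √C' * ‖v - u‖ ^ 2 := by
    filter_upwards [hM] with v hvM
    obtain ⟨V, hV⟩ := exists_isState hc hvM
    rw [hV.controlToState_eq hc hvM, hU.controlToState_eq hc huM, hLu]
    have hjsub : j v - j u = j (v - u) := (map_sub j v u).symm
    have hh4 : MemLp (j v - j u : L2 Ω) 4 (volume.restrict Ω) := hjsub ▸ (hj _).1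
    have hδle : ‖V - U‖ ≤ K * ‖j‖ * ‖v - u‖ := by
      refine (hK (j u) (j v) U V hU hV huM hvM hh4).trans ?_
      rw [hjsub, mul_assoc]
      gcongr
      exact j.le_opNorm _
    have hpair := gibbsPair_of_isState hU hV huM hvM (hcle _ U huM hU) (hcle _ V hvM hV)
      (hS _).1 hh4
    have hrem := norm_sq_state_sub_linearized_le hc hcpos hU hV huM hvM hpair hD hDnn
      (w := G (-(D (j v - j u)))) (hG _)
    rw [← hC] at hrem
    have hk4 : ∫ x in Ω, ((h01Fun V x + j v x) - (h01Fun U x + j u x)) ^ 4 ≤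
        8 * (|C₁| * (K * ‖j‖) ^ 4 + |C₂|) * ‖v - u‖ ^ 4 := by
      have i1 := integrable_pow_four (hS (V - U)).1
      have i2 := integrable_pow_four (hj (v - u)).1
      have hle : ∫ x in Ω, ((h01Fun V x + j v x) - (h01Fun U x + j u x)) ^ 4 ≤
          ∫ x in Ω, 8 * (h01Fun (V - U) x ^ 4 + j (v - u) x ^ 4) := by
        refine integral_mono_ae (integrable_pow_four hpair.memLp_sub)
          ((i1.add i2).const_mul 8) ?_
        filter_upwards [coeFn_add_sub_add (j u) (j v) U V,
          Lp.coeFn_add (h01Fun (V - U)) (j v - j u)] with x h1 h2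
        rw [← h1, h2, hjsub]
        exact add_pow_four_le _ _
      refine hle.trans ?_
      rw [integral_const_mul, integral_add i1 i2, mul_assoc]
      have h1 := hC₁ (V - U)
      have h2 := hC₂ (v - u)
      have h3 : |C₁| * ‖V - U‖ ^ 4 ≤ |C₁| * (K * ‖j‖ * ‖v - u‖) ^ 4 := by gcongr
      rw [mul_pow _ ‖v - u‖] at h3
      linarith
    have e : h01Fun V - h01Fun U - h01Fun (G (-(D (j (v - u))))) =
        h01Fun (V - U - G (-(D (j v - j u)))) := by rw [hjsub]; rfl
    rw [e]
    refine le_of_sq_le_sq (hrem.trans ?_) (by positivity)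
    rw [mul_pow, Real.sq_sqrt hC'0, ← pow_mul, hC', mul_assoc (16 * C), ← mul_assoc 16 C]
    exact mul_le_mul_of_nonneg_left hk4 (by positivity)
  have hbig : (fun v => controlToState Ω (j v) - controlToState Ω (j u) - L (v - u))
      =O[𝓝[A] u] fun v => ‖v - u‖ ^ 2 := by
    refine Asymptotics.IsBigO.of_bound (√C') ?_
    filter_upwards [key] with v hv
    rwa [Real.norm_of_nonneg (by positivity)]
  have h0 := hbig.hasFDerivWithinAt (𝕜 := ℝ) hu (by norm_num)
  have h1 := (L.hasFDerivWithinAt (s := A) (x := u)).add (h0.add_const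
    (controlToState Ω (j u) - L u))
  refine DifferentiableWithinAt.congr h1.differentiableWithinAt (fun v _ => ?_) ?_
  · simp only [Pi.add_apply, map_sub]; abel
  · simp only [Pi.add_apply, map_sub]; abel

/-! ### Sobolev embeddings of `H¹₀(Ω)` -/

lemma norm_h01Deriv_le (v : H01 Ω) (i : Fin n) : ‖h01Deriv v i‖ ≤ ‖v‖ :=
  PiLp.norm_apply_le (v : Jet1 Ω) (some i)

/-- An `Lᵖ` bound on test functions extends to `H¹₀(Ω)` by Fatou's lemma. -/
lemma eLpNorm_h01Fun_le_of_isTest {p : ℝ≥0∞} {C : NNReal}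
    (h : ∀ (w : H01 Ω) (φ : EuclideanSpace ℝ (Fin n) → ℝ), IsTest w φ →
      eLpNorm φ p (volume.restrict Ω) ≤ C * ‖w‖ₑ) (w : H01 Ω) :
    eLpNorm (h01Fun w) p (volume.restrict Ω) ≤ C * ‖w‖ₑ := by
  obtain ⟨W, φ, hW, hlim⟩ := exists_seq_isTest w
  obtain ⟨ns, hns, hae⟩ := exists_subseq_tendsto_ae
    (((h01FunL Ω).continuous.tendsto w).comp hlim)
  refine (Lp.eLpNorm_lim_le_liminf_eLpNorm (fun k => Lp.aestronglyMeasurable _) _ hae).trans ?_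
  have h1 : Tendsto (fun k => (C : ℝ≥0∞) * ‖W (ns k)‖ₑ) atTop (𝓝 (C * ‖w‖ₑ)) :=
    ENNReal.Tendsto.const_mul ((hlim.comp hns.tendsto_atTop).enorm) (Or.inr (by simp))
  rw [← h1.liminf_eq]
  refine liminf_le_liminf (Eventually.of_forall fun k => ?_)
  exact (eLpNorm_congr_ae (hW (ns k)).fun_eq).trans_le (h _ _ (hW _))

lemma support_pderiv_subset {i : Fin n} {φ : EuclideanSpace ℝ (Fin n) → ℝ} :
    Function.support (pderiv i φ) ⊆ tsupport φ := by
  refine Subset.trans (fun x hx => ?_) (support_fderiv_subset ℝ)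
  intro h0
  exact hx (by simp [pderiv, h0])

lemma IsTest.eLpNorm_pderiv_le {w : H01 Ω} {φ : EuclideanSpace ℝ (Fin n) → ℝ} (h : IsTest w φ)
    {p : ℝ≥0∞} (hp : p ≤ 2) (i : Fin n) :
    eLpNorm (pderiv i φ) p volume ≤
      ‖w‖ₑ * (volume.restrict Ω) univ ^ (1 / p.toReal - 1 / (2 : ℝ≥0∞).toReal) := by
  have hsupp : Function.support (pderiv i φ) ⊆ Ω := support_pderiv_subset.trans h.test.2.2
  rw [← eLpNorm_restrict_eq_of_support_subset hsupp]
  refine (eLpNorm_le_eLpNorm_mul_rpow_measure_univ hp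
    (h.test.continuous_pderiv i).aestronglyMeasurable).trans ?_
  gcongr
  rw [← eLpNorm_congr_ae (h.deriv_eq i), ← Lp.enorm_def]
  exact enorm_le_iff_norm_le.2 (norm_h01Deriv_le w i)

lemma norm_fderiv_le_sum_pderiv (φ : EuclideanSpace ℝ (Fin n) → ℝ)
    (x : EuclideanSpace ℝ (Fin n)) : ‖fderiv ℝ φ x‖ ≤ ∑ i, ‖pderiv i φ x‖ := by
  refine ContinuousLinearMap.opNorm_le_bound _ (by positivity) fun v => ?_
  have e : fderiv ℝ φ x v = ∑ i, v i * pderiv i φ x := by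
    conv_lhs => rw [← (EuclideanSpace.basisFun (Fin n) ℝ).sum_repr v]
    simp [pderiv]
  rw [e, Finset.sum_mul]
  refine (norm_sum_le _ _).trans (Finset.sum_le_sum fun i _ => ?_)
  rw [norm_mul, mul_comm]
  gcongr
  exact PiLp.norm_apply_le v i

lemma integral_pow_four_le {f : L2 Ω} {C : ℝ} (hC : 0 ≤ C)
    (h : eLpNorm f 4 (volume.restrict Ω) ≤ ENNReal.ofReal C) :
    MemLp f 4 (volume.restrict Ω) ∧ ∫ x in Ω, f x ^ 4 ≤ C ^ 4 := by
  have hm : MemLp f 4 (volume.restrict Ω) :=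
    ⟨Lp.aestronglyMeasurable f, h.trans_lt ENNReal.ofReal_lt_top⟩
  refine ⟨hm, ?_⟩
  rw [hm.eLpNorm_eq_integral_rpow_norm (by norm_num) (by norm_num),
    ENNReal.ofReal_le_ofReal_iff hC] at h
  have e : ∫ x in Ω, ‖f x‖ ^ (4 : ℝ≥0∞).toReal = ∫ x in Ω, f x ^ 4 := by
    refine integral_congr_ae (Eventually.of_forall fun x => ?_)
    have : (4 : ℝ≥0∞).toReal = (4 : ℕ) := by simp
    simp only [this, Real.rpow_natCast, Real.norm_eq_abs, Even.pow_abs (show Even 4 by decide)]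
  rw [e] at h
  have h0 : 0 ≤ ∫ x in Ω, f x ^ 4 := integral_nonneg fun x => by positivity
  have h1 := Real.rpow_le_rpow (by positivity) h (show (0 : ℝ) ≤ (4 : ℝ≥0∞).toReal by simp)
  rw [← Real.rpow_mul h0, inv_mul_cancel₀ (by simp), Real.rpow_one] at h1
  have : (4 : ℝ≥0∞).toReal = (4 : ℕ) := by simp
  rwa [this, Real.rpow_natCast] at h1

/-- `H¹₀(Ω) ⊂ L⁴(Ω)` in dimensions two and three, from the Gagliardo–Nirenberg–Sobolev inequality
with gradient exponent `7/4`, which is less than the dimension and admits the exponent `4` in both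
cases. -/
lemma exists_eLpNorm_four_le (hn : n = 2 ∨ n = 3) (hb : Bornology.IsBounded Ω) :
    ∃ C : ℝ, ∀ w : H01 Ω, MemLp (h01Fun w) 4 (volume.restrict Ω) ∧
      ∫ x in Ω, h01Fun w x ^ 4 ≤ C * ‖w‖ ^ 4 := by
  set p : NNReal := 7 / 4 with hp
  have hp2 : (p : ℝ≥0∞) ≤ 2 := by
    have : p ≤ 2 := by rw [hp, div_le_iff₀ (by norm_num)]; norm_num
    exact_mod_cast this
  set K : ℝ≥0∞ := (volume.restrict Ω) univ ^ (1 / (p : ℝ≥0∞).toReal - 1 / (2 : ℝ≥0∞).toReal)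
    with hK
  have hKtop : K ≠ ⊤ := by
    refine ENNReal.rpow_ne_top_of_nonneg ?_ ?_
    · rw [hp]; norm_num
    · rw [Measure.restrict_apply_univ]
      exact hb.measure_lt_top.ne
  set S := eLpNormLESNormFDerivOfLeConst ℝ (volume : Measure (EuclideanSpace ℝ (Fin n))) Ω p 4
  have htest : ∀ (w : H01 Ω) (φ : EuclideanSpace ℝ (Fin n) → ℝ), IsTest w φ →
      eLpNorm φ (4 : NNReal) (volume.restrict Ω) ≤ ((S * (n * K.toNNReal) : NNReal)) * ‖w‖ₑ := by
    intro w φ hw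
    have hsupp : Function.support φ ⊆ Ω := (subset_tsupport φ).trans hw.test.2.2
    rw [eLpNorm_restrict_eq_of_support_subset hsupp]
    have h1 := eLpNorm_le_eLpNorm_fderiv_of_le (F := ℝ) volume (u := φ) (s := Ω) (p := p) (q := 4)
      (hw.test.1.of_le (by simp)) hsupp
      (by rw [hp, le_div_iff₀ (by norm_num)]; norm_num)
      (by
        rw [finrank_euclideanSpace_fin, hp]
        rcases hn with rfl | rfl <;> rw [div_lt_iff₀ (by norm_num)] <;> norm_num)
      (by
        rw [finrank_euclideanSpace_fin, hp]
        rcases hn with rfl | rfl <;> push_cast <;> norm_num) hb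
    refine h1.trans ?_
    have h2 : eLpNorm (fderiv ℝ φ) p volume ≤ ∑ _i : Fin n, ‖w‖ₑ * K := by
      refine (eLpNorm_mono_real (g := ∑ i, fun x => ‖pderiv i φ x‖) fun x => by
        simpa using norm_fderiv_le_sum_pderiv φ x).trans ?_
      refine (eLpNorm_sum_le (fun i _ =>
        (hw.test.continuous_pderiv i).norm.aestronglyMeasurable) ?_).trans ?_
      · have : 1 ≤ p := by rw [hp, le_div_iff₀ (by norm_num)]; norm_num
        exact_mod_cast this
      refine Finset.sum_le_sum fun i _ => ?_
      rw [eLpNorm_norm]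
      exact hw.eLpNorm_pderiv_le hp2 i
    rw [ENNReal.coe_mul, mul_assoc]
    gcongr
    refine h2.trans_eq ?_
    rw [Finset.sum_const, Finset.card_univ, Fintype.card_fin, nsmul_eq_mul, ENNReal.coe_mul,
      ENNReal.coe_toNNReal hKtop, ENNReal.coe_natCast]
    ring
  set C : NNReal := S * (n * K.toNNReal)
  refine ⟨(C : ℝ) ^ 4, fun w => ?_⟩
  rw [← mul_pow]
  refine integral_pow_four_le (by positivity) ?_
  have := eLpNorm_h01Fun_le_of_isTest htest w
  rw [ENNReal.ofReal_mul (by positivity), ofReal_norm, ENNReal.ofReal_coe_nnreal]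
  exact_mod_cast this

lemma integral_pow_four_le_of_ae_le [IsFiniteMeasure (volume.restrict Ω)] {f : L2 Ω} {B : ℝ}
    (h : ∀ᵐ x ∂volume.restrict Ω, |f x| ≤ B) :
    MemLp f 4 (volume.restrict Ω) ∧
      ∫ x in Ω, f x ^ 4 ≤ (volume.restrict Ω).real univ * B ^ 4 := by
  have hm : MemLp f 4 (volume.restrict Ω) := MemLp.of_bound (Lp.aestronglyMeasurable f) B h
  refine ⟨hm, ?_⟩
  calc ∫ x in Ω, f x ^ 4 ≤ ∫ _ in Ω, B ^ 4 := by
        refine integral_mono_ae (integrable_pow_four hm) (integrable_const _) ?_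
        filter_upwards [h] with x hx
        rw [← Even.pow_abs (show Even 4 by decide)]
        gcongr
    _ = _ := by simp [Measure.real]

/-- In dimension one `H¹₀(Ω) ⊂ L^∞(Ω)`, by the fundamental theorem of calculus. -/
lemma exists_ae_abs_h01Fun_le {Ω : Set (EuclideanSpace ℝ (Fin 1))} (hb : Bornology.IsBounded Ω) :
    ∃ C : ℝ, 0 ≤ C ∧ ∀ w : H01 Ω, ∀ᵐ x ∂volume.restrict Ω, |h01Fun w x| ≤ C * ‖w‖ := by
  set K : ℝ≥0∞ := (volume.restrict Ω) univ ^ (1 / (1 : ℝ≥0∞).toReal - 1 / (2 : ℝ≥0∞).toReal)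
    with hK
  have hKtop : K ≠ ⊤ := by
    refine ENNReal.rpow_ne_top_of_nonneg (by norm_num) ?_
    rw [Measure.restrict_apply_univ]
    exact hb.measure_lt_top.ne
  -- the isometry `ℝ → ℝ¹`
  let ι : ℝ →L[ℝ] EuclideanSpace ℝ (Fin 1) :=
    ContinuousLinearMap.toSpanSingleton ℝ (EuclideanSpace.single 0 1)
  have hι : ∀ x : EuclideanSpace ℝ (Fin 1), ι (x 0) = x := by
    intro x
    ext i
    fin_cases i
    simp [ι]
  have hmp : MeasurePreserving (fun x : EuclideanSpace ℝ (Fin 1) => x 0) :=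
    (volume_preserving_funUnique (Fin 1) ℝ).comp (PiLp.volume_preserving_ofLp (Fin 1))
  have htest : ∀ (w : H01 Ω) (φ : EuclideanSpace ℝ (Fin 1) → ℝ), IsTest w φ →
      eLpNorm φ ⊤ (volume.restrict Ω) ≤ K.toNNReal * ‖w‖ₑ := by
    intro w φ hw
    rw [eLpNorm_exponent_top]
    refine eLpNormEssSup_le_of_ae_enorm_bound (Eventually.of_forall fun x => ?_)
    have hψ : ContDiff ℝ 1 (φ ∘ ι) := (hw.test.1.of_le (by simp)).comp ι.contDiff
    have hψc : HasCompactSupport (φ ∘ ι) := by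
      refine hw.test.2.1.comp_isClosedEmbedding ?_
      refine Topology.IsClosedEmbedding.of_continuous_injective_isClosedMap ι.continuous
        (fun a b hab => ?_) ?_
      · simpa [ι] using congrArg (fun z : EuclideanSpace ℝ (Fin 1) => z 0) hab
      · exact (LinearMap.isClosedEmbedding_of_injective (f := ι.toLinearMap)
          (LinearMap.ker_eq_bot.2 fun a b hab => by
            simpa [ι] using congrArg (fun z : EuclideanSpace ℝ (Fin 1) => z 0) hab)).isClosedMap
    have h1 := hψc.enorm_le_lintegral_Ici_deriv hψ (x 0)
    have hder : ∀ t, deriv (φ ∘ ι) t = pderiv 0 φ (ι t) := by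
      intro t
      rw [fderiv_comp_deriv t (hw.test.1.differentiable (by simp) _) ι.differentiableAt,
        ι.deriv]
      simp [ι, pderiv]
    simp only [Function.comp_apply, hι] at h1
    refine h1.trans ((setLIntegral_le_lintegral _ _).trans ?_)
    have h2 : ∫⁻ t, ‖deriv (φ ∘ ι) t‖ₑ = eLpNorm (pderiv 0 φ) 1 volume := by
      rw [eLpNorm_one_eq_lintegral_enorm, ← hmp.lintegral_comp
        ((hψ.continuous_deriv le_rfl).enorm.measurable)]
      simp only [hder, hι]
    change ∫⁻ t, ‖deriv (φ ∘ ι) t‖ₑ ≤ _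
    rw [h2, ENNReal.coe_toNNReal hKtop, mul_comm]
    exact hw.eLpNorm_pderiv_le (by norm_num) 0
  refine ⟨K.toNNReal, by positivity, fun w => ?_⟩
  have h1 := eLpNorm_h01Fun_le_of_isTest htest w
  rw [eLpNorm_exponent_top] at h1
  filter_upwards [ae_le_eLpNormEssSup (f := h01Fun w) (μ := volume.restrict Ω)] with x hx
  have h2 := hx.trans h1
  rw [← ENNReal.ofReal_coe_nnreal, ← ofReal_norm w, ← ENNReal.ofReal_mul (by positivity),
    ← ofReal_norm, ENNReal.ofReal_le_ofReal_iff (by positivity)] at h2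
  exact h2

/-! ### Boundedness of functions with a Bessel potential in `L²` -/

section Fourier

open FourierTransform TemperedDistribution
open scoped SchwartzMap LineDeriv Laplacian

variable {E : Type*} [NormedAddCommGroup E] [InnerProductSpace ℝ E] [FiniteDimensional ℝ E]
  [MeasurableSpace E] [BorelSpace E]

lemma memLp_one_add_norm_sq_rpow {s : ℝ} (hs : Module.finrank ℝ E < 2 * s) :
    MemLp (fun x : E => (1 + ‖x‖ ^ 2) ^ (-s / 2)) 2 := by
  refine ⟨?_, ?_⟩
  · have : (fun x : E => (1 + ‖x‖ ^ 2) ^ (-s / 2)).HasTemperateGrowth := by fun_prop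
    exact this.1.continuous.aestronglyMeasurable
  · rw [eLpNorm_lt_top_iff_lintegral_rpow_enorm_lt_top (by norm_num) (by norm_num)]
    suffices h : ∫⁻ a : E, ENNReal.ofReal ‖(1 + ‖a‖ ^ 2) ^ (-s)‖ < ⊤ from by
      norm_cast
      simp_rw [ofReal_norm] at h
      simp_rw [← enorm_pow]
      convert h
      rw [← Real.rpow_mul_natCast (by positivity)]
      simp
    apply ((integrable_rpow_neg_one_add_norm_sq hs).congr _).lintegral_lt_top
    filter_upwards with x
    rw [Real.norm_eq_abs, abs_eq_self.mpr (by positivity)]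
    congr
    ring

/-- The Fourier transform of `f` is `(1 + ‖ξ‖²)^(-s/2)` times that of its Bessel potential, a product
of two functions in `L²`. -/
lemma exists_fourier_eq_of_besselPotential_eq {s : ℝ} (hs : Module.finrank ℝ E < 2 * s) :
    ∃ C, 0 ≤ C ∧ ∀ f g : Lp ℂ 2 (volume : Measure E),
      besselPotential E ℂ s (f : 𝓢'(E, ℂ)) = (g : 𝓢'(E, ℂ)) →
      ∃ h : Lp ℂ 1 (volume : Measure E), 𝓕 (f : 𝓢'(E, ℂ)) = (h : 𝓢'(E, ℂ)) ∧ ‖h‖ ≤ C * ‖g‖ := by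
  have hw : MemLp (fun x : E => Complex.ofReal ((1 + ‖x‖ ^ 2) ^ (-s / 2) : ℝ)) 2 :=
    (memLp_one_add_norm_sq_rpow hs).ofReal
  refine ⟨‖hw.toLp‖, norm_nonneg _, fun f g hfg => ⟨hw.toLp • 𝓕 g, ?_, ?_⟩⟩
  · rw [Lp.toTemperedDistribution_smul_eq (by fun_prop), ← Lp.fourier_toTemperedDistribution_eq,
      ← hfg, fourier_besselPotential_eq_smulLeftCLM_fourier_apply,
      smulLeftCLM_smulLeftCLM_apply (by fun_prop) (by fun_prop)]
    refine (one_smul ℂ _).symm.trans ((smulLeftCLM_const 1 _).symm.trans ?_)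
    congr 2
    ext x
    rw [Pi.mul_apply]
    norm_cast
    rw [← Real.rpow_add (by positivity)]
    ring_nf
    simp
  · exact (Lp.norm_smul_le _ _).trans_eq (by rw [Lp.norm_fourier_eq])

lemma integral_fourierInv_smul {f g : E → ℂ} (hf : Integrable f) (hg : Integrable g) :
    ∫ ξ, 𝓕⁻ f ξ * g ξ = ∫ x, f x * 𝓕⁻ g x := by
  have hL : Continuous fun p : E × E => (-innerₗ E) p.1 p.2 := by
    simpa using! continuous_inner.neg
  have h := VectorFourier.integral_fourierIntegral_smul_eq_flip (μ := (volume : Measure E))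
    (ν := (volume : Measure E)) (L := -innerₗ E) Real.continuous_fourierChar hL hf hg
  have h' : ∀ x y : E, (-innerₗ E).flip x y = -inner ℝ x y := fun x y => by
    simp [real_inner_comm]
  simpa [Real.fourierInv_eq, VectorFourier.fourierIntegral, h'] using h

/-- The Sobolev embedding of `H^s` into `L^∞` for `s` greater than half the dimension, with the norm
of `H^s` expressed by the Bessel potential. -/
lemma exists_ae_norm_le_of_besselPotential_eq {s : ℝ} (hs : Module.finrank ℝ E < 2 * s) :
    ∃ C, 0 ≤ C ∧ ∀ f g : Lp ℂ 2 (volume : Measure E),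
      besselPotential E ℂ s (f : 𝓢'(E, ℂ)) = (g : 𝓢'(E, ℂ)) → ∀ᵐ x, ‖f x‖ ≤ C * ‖g‖ := by
  obtain ⟨C, hC, h⟩ := exists_fourier_eq_of_besselPotential_eq hs
  refine ⟨C, hC, fun f g hfg => ?_⟩
  obtain ⟨h, hh, hle⟩ := h f g hfg
  have hint : Integrable h := L1.integrable_coeFn h
  have hbd : ∀ x, ‖𝓕⁻ (h : E → ℂ) x‖ ≤ ‖h‖ := fun x => by
    rw [L1.norm_eq_integral_norm, Real.fourierInv_eq]
    exact (norm_integral_le_integral_norm _).trans_eq (by simp)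
  have hcont : Continuous (𝓕⁻ (h : E → ℂ)) := by
    rw [← Real.Lp.coe_fourierTransformInv]
    exact (Real.Lp.fourierTransformInv h).continuous
  -- `f` is the inverse Fourier transform of `h`, as is seen by testing with `ψ`
  have hae : ∀ᵐ x, f x = 𝓕⁻ (h : E → ℂ) x := by
    refine ae_eq_of_integral_contDiff_smul_eq ((Lp.memLp f).locallyIntegrable (by norm_num))
      hcont.locallyIntegrable fun ψ hψ hψc => ?_
    have h1 : HasCompactSupport (Complex.ofRealCLM ∘ ψ) := hψc.comp_left rfl
    have h2 : ContDiff ℝ ∞ (Complex.ofRealCLM ∘ ψ) := Complex.ofRealCLM.contDiff.comp hψ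
    set Ψ : 𝓢(E, ℂ) := h1.toSchwartzMap h2 with hΨ
    have h3 : (f : 𝓢'(E, ℂ)) Ψ = (h : 𝓢'(E, ℂ)) (𝓕⁻ Ψ) := by
      rw [← hh, TemperedDistribution.fourier_apply, fourier_fourierInv_eq]
    rw [Lp.toTemperedDistribution_apply, Lp.toTemperedDistribution_apply] at h3
    have h4 := integral_fourierInv_smul (Ψ.integrable (μ := volume)) hint
    simp only [smul_eq_mul, SchwartzMap.fourierInv_coe] at h3
    rw [h4] at h3
    simpa [hΨ] using h3
  filter_upwards [hae] with x hx
  rw [hx]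
  exact (hbd x).trans hle

end Fourier

/-! ### Boundedness of the elements of `H²₀(Ω)` -/

lemma memLp_indicator_ofReal (hΩ : MeasurableSet Ω) (f : L2 Ω) :
    MemLp (Ω.indicator fun x => (f x : ℂ)) 2 volume :=
  (memLp_indicator_iff_restrict hΩ).2 (Lp.memLp f).ofReal

/-- Extension of the elements of `L²(Ω)` by zero, with complex values. -/
def zeroExtend (hΩ : MeasurableSet Ω) :
    L2 Ω →L[ℝ] Lp ℂ 2 (volume : Measure (EuclideanSpace ℝ (Fin n))) :=
  LinearMap.mkContinuous
    { toFun := fun f => (memLp_indicator_ofReal hΩ f).toLp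
      map_add' := fun f g => by
        rw [← MemLp.toLp_add]
        refine MemLp.toLp_congr _ _ ?_
        filter_upwards [(ae_restrict_iff' hΩ).1 (Lp.coeFn_add f g)] with x hx
        by_cases hxΩ : x ∈ Ω
        · simp only [indicator_of_mem hxΩ, Pi.add_apply, hx hxΩ, Complex.ofReal_add]
        · simp [hxΩ]
      map_smul' := fun c f => by
        rw [RingHom.id_apply, ← MemLp.toLp_const_smul]
        refine MemLp.toLp_congr _ _ ?_
        filter_upwards [(ae_restrict_iff' hΩ).1 (Lp.coeFn_smul c f)] with x hx
        by_cases hxΩ : x ∈ Ω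
        · simp only [indicator_of_mem hxΩ, Pi.smul_apply, hx hxΩ, smul_eq_mul,
            Complex.ofReal_mul, Complex.real_smul]
        · simp [hxΩ] } 1 fun f => by
    rw [one_mul]
    refine (Lp.norm_toLp _ (memLp_indicator_ofReal hΩ f)).trans_le ?_
    rw [eLpNorm_indicator_eq_eLpNorm_restrict hΩ, Lp.norm_def]
    exact (congrArg _ (eLpNorm_congr_norm_ae (by simp))).le

lemma coeFn_zeroExtend (hΩ : MeasurableSet Ω) (f : L2 Ω) :
    zeroExtend hΩ f =ᵐ[volume] Ω.indicator fun x => (f x : ℂ) :=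
  MemLp.coeFn_toLp (memLp_indicator_ofReal hΩ f)

lemma norm_zeroExtend_le (hΩ : MeasurableSet Ω) (f : L2 Ω) : ‖zeroExtend hΩ f‖ ≤ ‖f‖ := by
  have h : ‖zeroExtend hΩ‖ ≤ 1 := LinearMap.mkContinuous_norm_le _ zero_le_one _
  simpa using (zeroExtend hΩ).le_of_opNorm_le h f

lemma coeFn_zeroExtend_of_ae_eq (hΩ : MeasurableSet Ω) {f : L2 Ω}
    {φ : EuclideanSpace ℝ (Fin n) → ℝ} (h : f =ᵐ[volume.restrict Ω] φ)
    (hφ : Function.support φ ⊆ Ω) : zeroExtend hΩ f =ᵐ[volume] fun x => (φ x : ℂ) := by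
  refine (coeFn_zeroExtend hΩ f).trans ?_
  filter_upwards [(ae_restrict_iff' hΩ).1 h] with x hx
  by_cases hxΩ : x ∈ Ω
  · simp [hxΩ, hx hxΩ]
  · have : φ x = 0 := by
      by_contra h0
      exact hxΩ (hφ h0)
    simp [hxΩ, this]

section Distribution

open TemperedDistribution
open scoped SchwartzMap LineDeriv Laplacian

lemma IsTest.lineDeriv_zeroExtend (hΩ : MeasurableSet Ω) {w : H01 Ω}
    {φ : EuclideanSpace ℝ (Fin n) → ℝ} (h : IsTest w φ) (i : Fin n) :
    ∂_{EuclideanSpace.single i (1 : ℝ)}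
      (zeroExtend hΩ (h01Fun w) : 𝓢'(EuclideanSpace ℝ (Fin n), ℂ)) =
      zeroExtend hΩ (h01Deriv w i) := by
  have ht := h.test
  have h1 : HasCompactSupport fun x => (φ x : ℂ) := ht.2.1.comp_left (g := Complex.ofReal) rfl
  have h2 : ContDiff ℝ ∞ fun x => (φ x : ℂ) := Complex.ofRealCLM.contDiff.comp ht.1
  obtain ⟨Ψ, hΨ⟩ : ∃ Ψ : 𝓢(EuclideanSpace ℝ (Fin n), ℂ), ∀ x, Ψ x = φ x :=
    ⟨h1.toSchwartzMap h2, fun x => rfl⟩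
  have h3 : zeroExtend hΩ (h01Fun w) = Ψ.toLp 2 := by
    refine Lp.ext ?_
    filter_upwards [coeFn_zeroExtend_of_ae_eq hΩ h.fun_eq
        ((subset_tsupport _).trans ht.2.2), Ψ.coeFn_toLp 2] with x hx hx'
    rw [hx, hx', hΨ]
  have h4 : zeroExtend hΩ (h01Deriv w i) =
      (∂_{EuclideanSpace.single i (1 : ℝ)} Ψ).toLp 2 := by
    refine Lp.ext ?_
    filter_upwards [coeFn_zeroExtend_of_ae_eq hΩ (h.deriv_eq i)
        (support_pderiv_subset.trans ht.2.2),
      (∂_{EuclideanSpace.single i (1 : ℝ)} Ψ).coeFn_toLp 2] with x hx hx'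
    have h5 : fderiv ℝ (fun x => (φ x : ℂ)) x = Complex.ofRealCLM.comp (fderiv ℝ φ x) :=
      (Complex.ofRealCLM.hasFDerivAt.comp x
        ((ht.1.differentiable (by simp)) x).hasFDerivAt).fderiv
    rw [hx, hx', SchwartzMap.lineDerivOp_apply_eq_fderiv, funext hΨ, h5]
    rfl
  rw [h3, h4, Lp.toTemperedDistribution_toLp_eq, Lp.toTemperedDistribution_toLp_eq,
    lineDerivOp_toTemperedDistributionCLM_eq]

/-- Extension by zero of an element of `H¹₀(Ω)` commutes with differentiation in the sense of
distributions. -/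
lemma lineDeriv_zeroExtend (hΩ : MeasurableSet Ω) (v : H01 Ω) (i : Fin n) :
    ∂_{EuclideanSpace.single i (1 : ℝ)}
      (zeroExtend hΩ (h01Fun v) : 𝓢'(EuclideanSpace ℝ (Fin n), ℂ)) =
      zeroExtend hΩ (h01Deriv v i) := by
  obtain ⟨W, φ, hW, hlim⟩ := exists_seq_isTest v
  ext ψ
  have hc : ∀ (L : H01 Ω →L[ℝ] L2 Ω) (χ : 𝓢(EuclideanSpace ℝ (Fin n), ℂ)),
      Tendsto (fun k => (zeroExtend hΩ (L (W k)) : 𝓢'(EuclideanSpace ℝ (Fin n), ℂ)) χ) atTop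
        (𝓝 ((zeroExtend hΩ (L v) : 𝓢'(EuclideanSpace ℝ (Fin n), ℂ)) χ)) := fun L χ => by
    have h := (Lp.toTemperedDistributionCLM ℂ
      (volume : Measure (EuclideanSpace ℝ (Fin n))) 2).continuous
    have h' := (PointwiseConvergenceCLM.evalCLM (RingHom.id ℂ) ℂ χ).continuous.comp
      (h.comp ((zeroExtend hΩ).continuous.comp L.continuous))
    exact (h'.tendsto v).comp hlim
  refine tendsto_nhds_unique ?_ (hc (h01DerivL Ω i) ψ)
  simp only [h01DerivL_apply, ← (hW _).lineDeriv_zeroExtend hΩ, lineDerivOp_apply_apply]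
  exact hc (h01FunL Ω) _

/-- The Bessel potential of order two is `1 - (2π)⁻² Δ`. -/
lemma besselPotential_two_eq (f : 𝓢'(EuclideanSpace ℝ (Fin n), ℂ)) :
    besselPotential (EuclideanSpace ℝ (Fin n)) ℂ 2 f = f - ((2 * Real.pi) ^ 2)⁻¹ •
      ∑ i : Fin n,
        ∂_{EuclideanSpace.single i (1 : ℝ)} (∂_{EuclideanSpace.single i (1 : ℝ)} f) := by
  have h1 : besselPotential (EuclideanSpace ℝ (Fin n)) ℂ 2 f =
      f + fourierMultiplierCLM ℂ (fun x ↦ Complex.ofReal (‖x‖ ^ 2)) f := by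
    have h2 : (fun x : EuclideanSpace ℝ (Fin n) ↦ (((1 + ‖x‖ ^ 2) ^ ((2 : ℝ) / 2) : ℝ) : ℂ)) =
        (fun _ => (1 : ℂ)) + fun x ↦ Complex.ofReal (‖x‖ ^ 2) := by
      ext x
      simp
    rw [besselPotential, h2, fourierMultiplierCLM_apply,
      smulLeftCLM_add (by fun_prop) (by fun_prop), add_apply,
      FourierTransform.fourierInv_add, ← fourierMultiplierCLM_apply,
      ← fourierMultiplierCLM_apply, fourierMultiplierCLM_const]
    simp
  have h3 := laplacian_eq_fourierMultiplierCLM f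
  rw [laplacian_eq_sum (EuclideanSpace.basisFun (Fin n) ℝ)] at h3
  simp only [EuclideanSpace.basisFun_apply] at h3
  rw [h3, smul_smul, h1]
  have h4 : ((2 * Real.pi) ^ 2)⁻¹ * -(2 * Real.pi) ^ 2 = -1 := by
    have := Real.pi_pos
    field_simp
  rw [h4]
  simp

end Distribution

/-- `H²₀(Ω)` is embedded into `L^∞(Ω)` in dimension at most three: the extension by zero of
`v ∈ H²₀(Ω)` belongs to `H²(ℝⁿ)`, so that its Fourier transform is integrable. -/
lemma exists_ae_abs_h02Fun_le (hn : n ≤ 3) (hΩ : MeasurableSet Ω) :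
    ∃ C, 0 ≤ C ∧ ∀ v : H02 Ω, ∀ᵐ x ∂volume.restrict Ω, |h02Fun v x| ≤ C * ‖v‖ := by
  have hs : (Module.finrank ℝ (EuclideanSpace ℝ (Fin n)) : ℝ) < 2 * 2 := by
    rw [finrank_euclideanSpace_fin]
    exact lt_of_le_of_lt (Nat.cast_le.2 hn) (by norm_num)
  obtain ⟨C, hC, h⟩ := exists_ae_norm_le_of_besselPotential_eq hs
  set a : ℝ := ((2 * Real.pi) ^ 2)⁻¹ with ha
  have ha0 : 0 ≤ a := by positivity
  refine ⟨C * (1 + a * n), by positivity, fun v => ?_⟩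
  set g := zeroExtend hΩ (h02Fun v) - a • ∑ i, zeroExtend hΩ (v.1 (Sum.inr (i, i))) with hg
  have hgn : ‖g‖ ≤ (1 + a * n) * ‖v‖ := by
    have h1 : ∀ k, ‖zeroExtend hΩ (v.1 k)‖ ≤ ‖v‖ := fun k =>
      (norm_zeroExtend_le hΩ _).trans (PiLp.norm_apply_le (v : Jet2 Ω) k)
    calc ‖g‖ ≤ ‖zeroExtend hΩ (h02Fun v)‖ +
          ‖a • ∑ i, zeroExtend hΩ (v.1 (Sum.inr (i, i)))‖ := norm_sub_le _ _
      _ ≤ ‖v‖ + a * ∑ _i : Fin n, ‖v‖ := by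
        rw [norm_smul, Real.norm_of_nonneg ha0]
        gcongr
        · exact h1 _
        · exact (norm_sum_le _ _).trans (Finset.sum_le_sum fun i _ => h1 _)
      _ = (1 + a * n) * ‖v‖ := by simp; ring
  have hd : ∀ i, Lp.toTemperedDistribution (zeroExtend hΩ (v.1 (Sum.inr (i, i)))) = _ :=
    fun i => (lineDeriv_zeroExtend hΩ ⟨v.1.deriv i, v.2.2 i⟩ i).symm
  have hd' : ∀ i, Lp.toTemperedDistribution (zeroExtend hΩ (v.1 (Sum.inl (some i)))) = _ :=
    fun i => (lineDeriv_zeroExtend hΩ ⟨v.1.fst, v.2.1⟩ i).symm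
  have hb := h (zeroExtend hΩ (h02Fun v)) g ?_
  · rw [ae_restrict_iff' hΩ]
    filter_upwards [hb, coeFn_zeroExtend hΩ (h02Fun v)] with x hx hx' hxΩ
    rw [hx', indicator_of_mem hxΩ, Complex.norm_real, Real.norm_eq_abs] at hx
    refine hx.trans ?_
    rw [mul_assoc]
    gcongr
  · rw [besselPotential_two_eq, hg, ← Lp.toTemperedDistributionCLM_apply,
      ← Lp.toTemperedDistributionCLM_apply, map_sub, ContinuousLinearMap.map_smul_of_tower, map_sum]
    simp only [Lp.toTemperedDistributionCLM_apply]
    congr 2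
    refine Finset.sum_congr rfl fun i _ => ?_
    rw [hd]
    congr 1
    exact (hd' i).symm

/-! ### The control-to-state map -/

lemma existsUnique_isState (hc : poincareConstant Ω < 4) [IsFiniteMeasure (volume.restrict Ω)]
    [NeZero (volume.restrict Ω)] {u : L2 Ω} {M : ℝ} (hu : ∀ᵐ x ∂volume.restrict Ω, |u x| ≤ M) :
    ∃! U : H01 Ω, IsState Ω u U := by
  obtain ⟨U, hU⟩ := exists_isState hc hu
  exact ⟨U, hU, fun V hV => hU.unique hc hV hu⟩

lemma integral_pow_four_le_of_ae_le_mul_norm [IsFiniteMeasure (volume.restrict Ω)] {X : Type*}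
    [NormedAddCommGroup X] {f : X → L2 Ω} {C : ℝ}
    (h : ∀ v, ∀ᵐ x ∂volume.restrict Ω, |f v x| ≤ C * ‖v‖) (v : X) :
    MemLp (f v) 4 (volume.restrict Ω) ∧
      ∫ x in Ω, f v x ^ 4 ≤ ((volume.restrict Ω).real univ * C ^ 4) * ‖v‖ ^ 4 := by
  refine (integral_pow_four_le_of_ae_le (h v)).imp_right fun h' => h'.trans_eq ?_
  ring

/-- Differentiability of the control-to-state map on a space of controls which is continuously
embedded into `L^∞(Ω)`. -/
lemma differentiable_controlToState_of_ae_le (hc : poincareConstant Ω < 4)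
    [IsFiniteMeasure (volume.restrict Ω)] [NeZero (volume.restrict Ω)]
    {C₁ : ℝ} (hS : ∀ w : H01 Ω, MemLp (h01Fun w) 4 (volume.restrict Ω) ∧
      ∫ x in Ω, h01Fun w x ^ 4 ≤ C₁ * ‖w‖ ^ 4)
    {X : Type*} [NormedAddCommGroup X] [NormedSpace ℝ X] (j : X →L[ℝ] L2 Ω) {C : ℝ} (hC : 0 ≤ C)
    (hj : ∀ v, ∀ᵐ x ∂volume.restrict Ω, |j v x| ≤ C * ‖v‖) :
    Differentiable ℝ fun v => controlToState Ω (j v) := fun u => by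
  rw [← differentiableWithinAt_univ]
  refine differentiableWithinAt_controlToState hc hS j (mem_univ u) (M := C * (‖u‖ + 1)) ?_
    (integral_pow_four_le_of_ae_le_mul_norm hj)
  rw [nhdsWithin_univ]
  filter_upwards [continuous_norm.continuousAt.eventually_lt continuousAt_const
    (lt_add_one ‖u‖)] with v hv
  filter_upwards [hj v] with x hx
  exact hx.trans (mul_le_mul_of_nonneg_left hv.le hC)

/-- `h02Fun` as a continuous linear map. -/
def h02FunL (Ω : Set (EuclideanSpace ℝ (Fin n))) : H02 Ω →L[ℝ] L2 Ω :=
  (PiLp.proj 2 (fun _ : Option (Fin n) ⊕ Fin n × Fin n => L2 Ω) (Sum.inl none)) ∘L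
    (H02 Ω).subtypeL

lemma ae_abs_le_of_mem_boundedControls {M₁ M₂ : ℝ} {u : H01 Ω}
    (hu : u ∈ boundedControls Ω M₁ M₂) :
    ∀ᵐ x ∂volume.restrict Ω, |h01Fun u x| ≤ max |M₁| |M₂| := by
  filter_upwards [(show ∀ᵐ x ∂volume.restrict Ω, _ from hu)] with x hx
  exact abs_le_max_abs_abs hx.1 hx.2

end PoissonBoltzmann

end

open PoissonBoltzmann in
theorem mainTheorem3 {n : ℕ} (Ω : Set (EuclideanSpace ℝ (Fin n))) (hΩ : IsLipschitzDomain Ω)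
    (hc : poincareConstant Ω < 4) :
    (n = 1 →
      (∀ u : H01 Ω, ∃! U : H01 Ω, IsState Ω (h01Fun u) U) ∧
      Differentiable ℝ (fun u : H01 Ω => controlToState Ω (h01Fun u))) ∧
    (n = 2 ∨ n = 3 →
      (∀ M₁ M₂ : ℝ,
        (∀ u ∈ boundedControls Ω M₁ M₂, ∃! U : H01 Ω, IsState Ω (h01Fun u) U) ∧
        DifferentiableOn ℝ (fun u : H01 Ω => controlToState Ω (h01Fun u))
          (boundedControls Ω M₁ M₂)) ∧
      (∀ u : H02 Ω, ∃! U : H01 Ω, IsState Ω (h02Fun u) U) ∧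
      Differentiable ℝ (fun u : H02 Ω => controlToState Ω (h02Fun u))) := by
  have : IsFiniteMeasure (volume.restrict Ω) :=
    isFiniteMeasure_restrict.2 hΩ.isBounded.measure_lt_top.ne
  have : NeZero (volume.restrict Ω) :=
    ⟨Measure.restrict_eq_zero.not.2 (hΩ.isOpen.measure_pos _ hΩ.isConnected.nonempty).ne'⟩
  refine ⟨fun hn => ?_, fun hn => ?_⟩
  · subst hn
    obtain ⟨C, hC, h⟩ := exists_ae_abs_h01Fun_le hΩ.isBounded
    exact ⟨fun u => existsUnique_isState hc (h u), differentiable_controlToState_of_ae_le hc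
      (integral_pow_four_le_of_ae_le_mul_norm h) (h01FunL Ω) hC h⟩
  · obtain ⟨C₁, hS⟩ := exists_eLpNorm_four_le hn hΩ.isBounded
    obtain ⟨C, hC, h⟩ := exists_ae_abs_h02Fun_le (by lia) hΩ.isOpen.measurableSet
    refine ⟨fun M₁ M₂ => ⟨fun u hu => existsUnique_isState hc
      (ae_abs_le_of_mem_boundedControls hu), fun u hu => ?_⟩,
      fun u => existsUnique_isState hc (h u),
      differentiable_controlToState_of_ae_le hc hS (h02FunL Ω) hC h⟩
    refine differentiableWithinAt_controlToState hc hS (h01FunL Ω) hu (M := max |M₁| |M₂|) ?_ hS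
    filter_upwards [self_mem_nhdsWithin] with v hv
    exact ae_abs_le_of_mem_boundedControls hv
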